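/- **Setting.** Let $\mathcal X$ be a measurable space, $k:\mathcal X\times\mathcal X\to\mathbb R$ a measurable scalar-valued positive semidefinite kernel with $k(x,x')\le\kappa$ for all $x,x'\in\mathcal X$, $M\in\mathbb R^{d\times d}$ an invertible positive semidefinite matrix, and $\mathcal H_{\mathcal K}$ the vector-valued reproducing kernel Hilbert space of functions $\mathcal X\to\mathbb R^d$ with the decomposable kernel $\mathcal K=kM$. Let $(x_1,y_1),\dots,(x_n,y_n)$, $n\ge1$, be i.i.d. with law $P$ on $\mathcal X\times\mathcal Y$, $\mathcal Y\subseteq\mathbb R^d$, let $\ell:\mathbb R^d\times\mathbb R^d\to\mathbb R$ be a measurable loss, and write $\mathbb E[\ell_f]=\mathbb E_{(X,Y)\sim P}[\ell(f(X),Y)]$. Assume that $\ell(f(x),y)\in[0,1]$ for all $f\in\mathcal H_{\mathcal K}$ with $\|f\|_{\mathcal H_{\mathcal K}}\le1$, $x\in\mathcal X$, $y\in\mathcal Y$. Assume that the true risk $f\mapsto\mathbb E[\ell_f]$ is minimized over $\mathcal H_{\mathcal K}$ at a function $f_{\mathcal H_{\mathcal K}}$ with $\|f_{\mathcal H_{\mathcal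 K}}\|_{\mathcal H_{\mathcal K}}\le1$. Let $K=(k(x_i,x_j))_{i,j}$ be the scalar Gram matrix, and $K/n=UDU^\top$ an eigendecomposition, with $U$ orthogonal and $D=\operatorname{diag}(\mu_1,\dots,\mu_n)$, $\mu_1\ge\dots\ge\mu_n$. Let $\delta_n$ be the infimum of the $r>0$ with $\big(\frac1n\sum_{i=1}^n\min(r^2,\mu_i)\big)^{1/2}\le r^2$, and let $d_n=\min\{j\in\{1,\dots,n\}:\mu_j\le\delta_n^2\}$, with $d_n=n$ if there is no such $j$. Let $U_1$ and $U_2$ consist of the first $d_n$ and the last $n-d_n$ columns of $U$, and let $D_2=\operatorname{diag}(\mu_{d_n+1},\dots,\mu_n)$. Let $c>0$ be a constant and assume that the sketch matrix $S\in\mathbb R^{s\times n}$ (which may be random) is $K$-satisfiable for $c$ almost surely, that is, $$\big\|(SU_1)^\top SU_1-I_{d_n}\big\|_{\mathrm{op}}\le\tfrac12,\qquad \big\|SU_2D_2^{1/2}\big\|_{\mathrm{op}}\le c\,\delta_n .$$ Let $\lambda_n>0$. For $\Gamma\in\mathbb R^{s\times d}$ put $f_\Gamma=\sum_{j=1}^n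 k(\cdot,x_j)M[S^\top\Gamma]_{j:}^\top\in\mathcal H_{\mathcal K}$, and let $\tilde f_s=f_{\tilde\Gamma}$, where $\tilde\Gamma$ minimizes $$\frac1n\sum_{i=1}^n\ell\big([KS^\top\Gamma M]_{i:}^\top,y_i\big)+\frac{\lambda_n}2\operatorname{Tr}\big(SKS^\top\Gamma M\Gamma^\top\big)$$ over all $\Gamma\in\mathbb R^{s\times d}$ with $\|f_\Gamma\|_{\mathcal H_{\mathcal K}}\le1$. Let $C=1+\sqrt6\,c$. **Theorem.** (i) If $z\mapsto\ell(z,y)$ is $L$-Lipschitz for every $y\in\mathcal Y$ (Euclidean norm), then for every $\delta\in(0,1)$, with probability at least $1-\delta$, $$\mathbb E[\ell_{\tilde f_s}]\le\mathbb E[\ell_{f_{\mathcal H_{\mathcal K}}}]+LC\sqrt{\lambda_n+\|M\|_{\mathrm{op}}\,\delta_n^2}+\frac{\lambda_n}2+8L\sqrt{\frac{\kappa\operatorname{Tr}(M)}n}+2\sqrt{\frac{8\log(4/\delta)}n}.$$ (ii) If $\ell(z,y)=\|z-y\|_2^2/2$ and $\mathcal Y$ is contained in the closed unit ball of $\mathbb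 R^d$, then for every $\delta\in(0,1)$, with probability at least $1-\delta$, $$\mathbb E[\ell_{\tilde f_s}]\le\mathbb E[\ell_{f_{\mathcal H_{\mathcal K}}}]+\Big(C^2+\frac12\Big)\lambda_n+C^2\|M\|_{\mathrm{op}}\,\delta_n^2+8\operatorname{Tr}(M)^{1/2}\,\frac{\kappa\|M\|_{\mathrm{op}}^{1/2}+\kappa^{1/2}}{\sqrt n}+2\sqrt{\frac{8\log(4/\delta)}n}.$$ -/

import Mathlib

open MeasureTheory ProbabilityTheory

noncomputable section

namespace SketchedKernel

/-- A scalar-valued kernel: a symmetric, positive semidefinite function on `X × X`. -/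
structure IsScalarKernel {X : Type*} (k : X → X → ℝ) : Prop where
  symm : ∀ x x' : X, k x x' = k x' x
  nonneg : ∀ (n : ℕ) (x : Fin n → X) (a : Fin n → ℝ),
    0 ≤ ∑ i, ∑ j, a i * k (x i) (x j) * a j

/-- The vector-valued RKHS `H` of functions `X → ℝ^d` (Mathlib's `RKHS`) has the decomposable
matrix-valued kernel `(x, x') ↦ k(x, x') M`, where `k` is a scalar kernel and `M` is a positive
semidefinite `d × d` matrix. -/
structure HasDecomposableKernel {X : Type*} {d : ℕ} (H : Type*) [NormedAddCommGroup H]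
    [InnerProductSpace ℝ H] [CompleteSpace H] [RKHS ℝ H X (EuclideanSpace ℝ (Fin d))]
    (k : X → X → ℝ) (M : Matrix (Fin d) (Fin d) ℝ) : Prop where
  scalar : IsScalarKernel k
  posSemidef : M.PosSemidef
  kernel_eq : ∀ x x' : X, RKHS.kernel H x x' = k x x' • Matrix.toEuclideanCLM (𝕜 := ℝ) M

/-- The scalar Gram matrix `K i j = k (x i) (x j)`. -/
def gram {X : Type*} {n : ℕ} (k : X → X → ℝ) (x : Fin n → X) : Matrix (Fin n) (Fin n) ℝ :=
  Matrix.of fun i j => k (x i) (x j)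

/-- Operator norm of a real matrix between Euclidean spaces. -/
def opNorm {m p : Type*} [Fintype m] [Fintype p] [DecidableEq p] (A : Matrix m p ℝ) : ℝ :=
  ‖LinearMap.toContinuousLinearMap (Matrix.toEuclideanLin A)‖

/-- `A = U D Uᵀ` with `U` orthogonal and `D = diag(ev)`, the eigenvalues in decreasing order. -/
structure IsEigendecomposition {n : ℕ} (A U : Matrix (Fin n) (Fin n) ℝ) (ev : Fin n → ℝ) :
    Prop where
  orthogonal : U ∈ Matrix.orthogonalGroup (Fin n) ℝ
  antitone : Antitone ev
  eq_mul : A = U * Matrix.diagonal ev * U.transpose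

/-- `ψ(r) = ((1/n) ∑ i, min(r², μ_i))^{1/2}`. -/
def psi {n : ℕ} (ev : Fin n → ℝ) (r : ℝ) : ℝ :=
  √((1 / (n : ℝ)) * ∑ i, min (r ^ 2) (ev i))

/-- The critical radius `δ_n`: the least positive `r` with `ψ(r) ≤ r²`. (If all eigenvalues
vanish, every positive `r` qualifies, and `δ_n = 0`.) -/
def criticalRadius {n : ℕ} (ev : Fin n → ℝ) : ℝ :=
  sInf {r : ℝ | 0 < r ∧ psi ev r ≤ r ^ 2}

/-- The statistical dimension `d_n`: the least `j ∈ {1, …, n}` with `μ_j ≤ δ_n²`, and `n` if there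
is none. (`ev i` is the eigenvalue `μ_{i+1}`.) -/
def statDim {n : ℕ} (ev : Fin n → ℝ) : ℕ :=
  sInf ({j : ℕ | ∃ i : Fin n, j = (i : ℕ) + 1 ∧ ev i ≤ criticalRadius ev ^ 2} ∪ {n})

/-- The left block `U₁` of `U`: its first `r` columns. -/
def leftBlock {n : ℕ} (U : Matrix (Fin n) (Fin n) ℝ) (r : ℕ) :
    Matrix (Fin n) {i : Fin n // (i : ℕ) < r} ℝ :=
  U.submatrix id Subtype.val

/-- The right block `U₂` of `U`: its columns after the first `r` ones. -/
def rightBlock {n : ℕ} (U : Matrix (Fin n) (Fin n) ℝ) (r : ℕ) :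
    Matrix (Fin n) {i : Fin n // r ≤ (i : ℕ)} ℝ :=
  U.submatrix id Subtype.val

/-- The diagonal matrix `D₂^{1/2}` with entries `μ_{r+1}^{1/2}, …, μ_n^{1/2}`. -/
def sqrtRightDiag {n : ℕ} (ev : Fin n → ℝ) (r : ℕ) :
    Matrix {i : Fin n // r ≤ (i : ℕ)} {i : Fin n // r ≤ (i : ℕ)} ℝ :=
  Matrix.diagonal fun i => √(ev i.val)

/-- `K`-satisfiability of the sketch `S` with constant `c`, where `K/n = U diag(ev) Uᵀ`. -/
structure IsSatisfiable {n s : ℕ} (c : ℝ) (U : Matrix (Fin n) (Fin n) ℝ) (ev : Fin n → ℝ)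
    (S : Matrix (Fin s) (Fin n) ℝ) : Prop where
  isometry : opNorm ((S * leftBlock U (statDim ev)).transpose * (S * leftBlock U (statDim ev)) - 1)
    ≤ 1 / 2
  tail : opNorm (S * rightBlock U (statDim ev) * sqrtRightDiag ev (statDim ev))
    ≤ c * criticalRadius ev

/-- The sketched function `∑ j, 𝒦(·, x_j) [Sᵀ Γ]_j` of the vector-valued RKHS `H`; for `𝒦 = k M` it
is `∑ j, k(·, x_j) M [Sᵀ Γ]_j`. -/
def sketchedFun {X : Type*} {d n s : ℕ} (H : Type*) [NormedAddCommGroup H]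
    [InnerProductSpace ℝ H] [CompleteSpace H] [RKHS ℝ H X (EuclideanSpace ℝ (Fin d))]
    (x : Fin n → X) (S : Matrix (Fin s) (Fin n) ℝ) (Γ : Matrix (Fin s) (Fin d) ℝ) : H :=
  ∑ j, RKHS.kerFun H (x j) (WithLp.toLp 2 ((S.transpose * Γ) j))

/-- The sketched regularized empirical risk
`(1/n) ∑ i, ℓ([K Sᵀ Γ M]_i, y_i) + (lam/2) Tr(S K Sᵀ Γ M Γᵀ)`. -/
def sketchedObjective {d n s : ℕ}
    (ℓ : EuclideanSpace ℝ (Fin d) → EuclideanSpace ℝ (Fin d) → ℝ) (lam : ℝ)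
    (K : Matrix (Fin n) (Fin n) ℝ) (M : Matrix (Fin d) (Fin d) ℝ)
    (y : Fin n → EuclideanSpace ℝ (Fin d))
    (S : Matrix (Fin s) (Fin n) ℝ) (Γ : Matrix (Fin s) (Fin d) ℝ) : ℝ :=
  (1 / (n : ℝ)) * ∑ i, ℓ (WithLp.toLp 2 ((K * S.transpose * Γ * M) i)) (y i)
    + lam / 2 * (S * K * S.transpose * Γ * M * Γ.transpose).trace

/-- `Γ` solves the sketched problem with hypothesis set the unit ball of `H`: its function lies in
the unit ball, and it minimizes the objective among all parameters whose function does. -/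
structure IsSketchedSolution {X : Type*} {d n s : ℕ} (H : Type*) [NormedAddCommGroup H]
    [InnerProductSpace ℝ H] [CompleteSpace H] [RKHS ℝ H X (EuclideanSpace ℝ (Fin d))]
    (ℓ : EuclideanSpace ℝ (Fin d) → EuclideanSpace ℝ (Fin d) → ℝ) (lam : ℝ)
    (k : X → X → ℝ) (M : Matrix (Fin d) (Fin d) ℝ)
    (x : Fin n → X) (y : Fin n → EuclideanSpace ℝ (Fin d))
    (S : Matrix (Fin s) (Fin n) ℝ) (Γ : Matrix (Fin s) (Fin d) ℝ) : Prop where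
  mem_ball : ‖sketchedFun H x S Γ‖ ≤ 1
  le : ∀ Γ' : Matrix (Fin s) (Fin d) ℝ, ‖sketchedFun H x S Γ'‖ ≤ 1 →
    sketchedObjective ℓ lam (gram k x) M y S Γ ≤ sketchedObjective ℓ lam (gram k x) M y S Γ'

/-- The true risk `E[ℓ_f] = E_P[ℓ(f(X), Y)]`. -/
def risk {X : Type*} [MeasurableSpace X] {d : ℕ} {H : Type*} [NormedAddCommGroup H]
    [InnerProductSpace ℝ H] [RKHS ℝ H X (EuclideanSpace ℝ (Fin d))]
    (P : Measure (X × EuclideanSpace ℝ (Fin d)))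
    (ℓ : EuclideanSpace ℝ (Fin d) → EuclideanSpace ℝ (Fin d) → ℝ) (f : H) : ℝ :=
  ∫ p, ℓ (f p.1) p.2 ∂P

/-- `A` holds with probability at least `p`: it contains a measurable event of probability at
least `p` (for measurable `A`, this says `p ≤ Pr A`). -/
def WithProbAtLeast {Ω : Type*} [MeasurableSpace Ω] (Pr : Measure Ω) (p : ℝ) (A : Set Ω) : Prop :=
  ∃ G : Set Ω, MeasurableSet G ∧ G ⊆ A ∧ ENNReal.ofReal p ≤ Pr G

end SketchedKernel

end

noncomputable section

/-! ### Sign averages, Khintchine's inequality and vector contraction. -/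

namespace SketchedKernel

open scoped BigOperators

/-! The estimator is compared with one feasible competitor: the orthogonal projection `g` of `fH`
onto the space of sketched functions. Projection does not increase the norm, so `g` stays in the
unit ball, and optimality of `Γ` bounds the empirical risk of the estimator by that of `g` plus `lam
/ 2` (`IsSketchedSolution.exists_competitor`). It remains to see that `g` is close to `fH` on the
sample, and that empirical risks control true risks uniformly over the ball.

Closeness is a duality argument (`HasDecomposableKernel.exists_sketchedFun_approx`). Put `p = fH -
g` and `T = ∑ ‖p (x i)‖²`. By the reproducing property `T` is the inner product of `p` with `∑
kerFun (x i) (p (x i))`. As `p` is orthogonal to every sketched function, any `[Sᵀ Γ']_i` may be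
subtracted from the coefficients `p (x i)`. Satisfiability supplies a `Γ'` that matches the leading
eigencoordinates exactly and costs at most `C δ_n` in the tail
(`IsSatisfiable.exists_sum_ev_mul_sq_le`). Since `‖p‖ ≤ 1`, this gives `T² ≤ n ‖M‖ C² δ_n² T`, and
one factor `T` cancels.

Uniform deviation (`IsRegularLoss.exists_good_samples`) is one application of McDiarmid's inequality
to the expected gap to a ghost sample plus a statistic `Ψ`. The mean gap is bounded by
symmetrization, by the contraction `expect_iSup_signs_le_vector`, which turns losses into
coordinates of `f`, and by a second moment in `H`.

For a Lipschitz loss, `Ψ` is the empirical risk of `fH`, which cancels, and closeness enters through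
a root mean square. For the square loss the root is avoided: `square_expansion` writes the loss of
`g` as a squared distance to `fH`, a term linear in `g`, and an offset free of `g`. The linear term
is at most `gradNorm`, whose mean is of order `n^(-1/2)` because `fH` satisfies the first-order
condition over all of `H`; here `Ψ` is `gradNorm` plus the mean offset. -/

/-- The sign `±1` of a Boolean. -/
def signOf (b : Bool) : ℝ := if b then 1 else -1

@[simp] lemma signOf_true : signOf true = 1 := by simp [signOf]

@[simp] lemma signOf_false : signOf false = -1 := by simp [signOf]

@[simp] lemma signOf_not (b : Bool) : signOf (!b) = -signOf b := by cases b <;> simp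

lemma expect_bool (f : Bool → ℝ) : 𝔼 b, f b = (f true + f false) / 2 := by
  rw [Fintype.expect_eq_sum_div_card]; simp

lemma expect_fin_cons {n : ℕ} {α : Type*} [Fintype α] (F : (Fin (n + 1) → α) → ℝ) :
    𝔼 ε, F ε = 𝔼 a, 𝔼 ε : Fin n → α, F (Fin.cons a ε) := by
  have h1 : 𝔼 p : α × (Fin n → α), F (Fin.cons p.1 p.2) = 𝔼 ε, F ε :=
    Fintype.expect_equiv (Fin.consEquiv fun _ : Fin (n + 1) => α) _ _ fun p => rfl
  rw [← h1, ← Finset.univ_product_univ, Finset.expect_product]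

lemma expect_neg_signs {d : ℕ} (F : (Fin d → Bool) → ℝ) :
    𝔼 ε : Fin d → Bool, F (fun k => !ε k) = 𝔼 ε, F ε :=
  Fintype.expect_equiv (Equiv.piCongrRight fun _ => Equiv.boolNot) _ _ fun _ => rfl

/-- Averaging over one sign is the parallelogram law; the free vector `h₀` absorbs the signs already
treated in the induction. -/
lemma expect_norm_sq_add_signs {H : Type*} [NormedAddCommGroup H] [InnerProductSpace ℝ H] {d : ℕ}
    (h₀ : H) (h : Fin d → H) :
    𝔼 ε : Fin d → Bool, ‖h₀ + ∑ k, signOf (ε k) • h k‖ ^ 2 = ‖h₀‖ ^ 2 + ∑ k, ‖h k‖ ^ 2 := by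
  induction d generalizing h₀ with
  | zero => simp
  | succ d ih =>
    rw [expect_fin_cons, expect_bool]
    simp only [Fin.sum_univ_succ, Fin.cons_zero, Fin.cons_succ, ← add_assoc]
    rw [ih, ih]
    simp only [signOf_true, signOf_false, one_smul, neg_smul]
    have := parallelogram_law_with_norm ℝ h₀ (h 0)
    rw [← sub_eq_add_neg]
    linarith

lemma expect_norm_sq_add_signs₂ {H : Type*} [NormedAddCommGroup H] [InnerProductSpace ℝ H]
    {n d : ℕ} (h₀ : H) (h : Fin n → Fin d → H) :
    𝔼 ε : Fin n → Fin d → Bool, ‖h₀ + ∑ i, ∑ k, signOf (ε i k) • h i k‖ ^ 2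
      = ‖h₀‖ ^ 2 + ∑ i, ∑ k, ‖h i k‖ ^ 2 := by
  induction n generalizing h₀ with
  | zero => simp
  | succ n ih =>
    rw [expect_fin_cons]
    simp only [Fin.sum_univ_succ (n := n), Fin.cons_zero, Fin.cons_succ, ← add_assoc]
    simp_rw [ih]
    rw [Finset.expect_add_distrib, expect_norm_sq_add_signs, Fintype.expect_const]

lemma expect_sq_signs {d : ℕ} (v : Fin d → ℝ) :
    𝔼 ε : Fin d → Bool, (∑ k, signOf (ε k) * v k) ^ 2 = ∑ k, v k ^ 2 := by
  simpa using expect_norm_sq_add_signs (0 : ℝ) v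

lemma expect_pow_four_signs_le {d : ℕ} (v : Fin d → ℝ) :
    𝔼 ε : Fin d → Bool, (∑ k, signOf (ε k) * v k) ^ 4 ≤ 3 * (∑ k, v k ^ 2) ^ 2 := by
  induction d with
  | zero => simp
  | succ d ih =>
    rw [expect_fin_cons, expect_bool]
    simp only [Fin.sum_univ_succ, Fin.cons_zero, Fin.cons_succ, signOf_true, signOf_false]
    rw [← Finset.expect_add_distrib, Finset.expect_div]
    have h1 : ∀ ε : Fin d → Bool, ((1 * v 0 + ∑ k, signOf (ε k) * v k.succ) ^ 4
        + (-1 * v 0 + ∑ k, signOf (ε k) * v k.succ) ^ 4) / 2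
        = v 0 ^ 4 + 6 * v 0 ^ 2 * (∑ k, signOf (ε k) * v k.succ) ^ 2
          + (∑ k, signOf (ε k) * v k.succ) ^ 4 := fun ε => by ring
    simp_rw [h1]
    rw [Finset.expect_add_distrib, Finset.expect_add_distrib, Fintype.expect_const,
      ← Finset.mul_expect, expect_sq_signs fun k : Fin d => v k.succ]
    nlinarith [ih fun k => v k.succ, sq_nonneg (v 0 ^ 2)]

/-- An even quartic minorant of `|x|`, whose average over signs needs only second and fourth
moments. With `r = ‖v‖` that average is at least `r - 3 r⁴ / (6 r³) = r / 2`, which is the factor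
`2` in Khintchine's inequality. -/
lemma sub_pow_four_le_abs (x r : ℝ) (hr : 0 < r) :
    x ^ 2 / r - x ^ 4 / (6 * r ^ 3) ≤ |x| := by
  obtain ⟨t, ht⟩ : ∃ t, t = |x| / r := ⟨_, rfl⟩
  have ht0 : 0 ≤ t := by rw [ht]; positivity
  have hx : |x| = t * r := by rw [ht]; field_simp
  have h2 : x ^ 2 = (t * r) ^ 2 := by rw [← hx, sq_abs]
  have h4 : x ^ 4 = (t * r) ^ 4 := by
    rw [show x ^ 4 = (x ^ 2) ^ 2 by ring, h2]; ring
  rw [h2, h4, hx]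
  have e : (t * r) ^ 2 / r - (t * r) ^ 4 / (6 * r ^ 3) = (t - t ^ 3 / 6) * t * r := by
    field_simp
  rw [e]
  -- The maximum is `2√2/3`, at `t = √2`. The hint is `(t + 2a)(t - a)² = t³ - 3a²t + 2a³` with `a =
  -- 1.42` just above `√2`.
  have h : t - t ^ 3 / 6 ≤ 1 := by
    nlinarith [mul_nonneg (by linarith : (0 : ℝ) ≤ t + 284 / 100) (sq_nonneg (t - 142 / 100))]
  have : (t - t ^ 3 / 6) * (t * r) ≤ 1 * (t * r) :=
    mul_le_mul_of_nonneg_right h (by positivity)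
  linarith

/-- Khintchine's inequality, with a constant that is not optimal. -/
lemma sqrt_sum_sq_le_expect_abs {d : ℕ} (v : Fin d → ℝ) :
    √(∑ k, v k ^ 2) ≤ 2 * 𝔼 ε : Fin d → Bool, |∑ k, signOf (ε k) * v k| := by
  have hQ : 0 ≤ ∑ k, v k ^ 2 := Finset.sum_nonneg fun _ _ => sq_nonneg _
  rcases hQ.eq_or_lt with h0 | hpos
  · rw [← h0, Real.sqrt_zero]
    exact mul_nonneg (by norm_num) (Finset.expect_nonneg fun _ _ => abs_nonneg _)
  · set r := √(∑ k, v k ^ 2) with hr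
    have hrpos : 0 < r := Real.sqrt_pos.2 hpos
    have hr2 : ∑ k, v k ^ 2 = r ^ 2 := (Real.sq_sqrt hQ).symm
    have h1 : 𝔼 ε : Fin d → Bool, ((∑ k, signOf (ε k) * v k) ^ 2 / r
        - (∑ k, signOf (ε k) * v k) ^ 4 / (6 * r ^ 3))
        ≤ 𝔼 ε : Fin d → Bool, |∑ k, signOf (ε k) * v k| :=
      Finset.expect_le_expect fun ε _ => sub_pow_four_le_abs _ _ hrpos
    rw [Finset.expect_sub_distrib, ← Finset.expect_div, ← Finset.expect_div,
      expect_sq_signs, hr2] at h1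
    have h4 := expect_pow_four_signs_le v
    rw [hr2] at h4
    have h5 : (𝔼 ε : Fin d → Bool, (∑ k, signOf (ε k) * v k) ^ 4) / (6 * r ^ 3) ≤ r / 2 := by
      rw [div_le_div_iff₀ (by positivity) (by norm_num)]
      nlinarith
    have h6 : r ^ 2 / r = r := by field_simp
    linarith

section Contraction

variable {T : Type*} {d : ℕ}

lemma bddAbove_range_add_of_abs_le {a b : T → ℝ} (ha : BddAbove (Set.range a))
    (hb : ∃ B, ∀ f, |b f| ≤ B) : BddAbove (Set.range fun f => a f + b f) := by
  obtain ⟨A, hA⟩ := ha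
  obtain ⟨B, hB⟩ := hb
  refine ⟨A + B, ?_⟩
  rintro _ ⟨f, rfl⟩
  exact add_le_add (hA ⟨f, rfl⟩) ((le_abs_self _).trans (hB f))

lemma abs_sum_signOf_mul_le {v : T → Fin d → ℝ} {B : ℝ} (hB : ∀ f k, |v f k| ≤ B)
    (ε : Fin d → Bool) (f : T) : |∑ k, signOf (ε k) * v f k| ≤ d * B := by
  calc |∑ k, signOf (ε k) * v f k| ≤ ∑ k, |signOf (ε k) * v f k| :=
        Finset.abs_sum_le_sum_abs _ _
    _ ≤ ∑ _k : Fin d, B := by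
        refine Finset.sum_le_sum fun k _ => ?_
        have : |signOf (ε k)| = 1 := by cases ε k <;> simp
        rw [abs_mul, this, one_mul]
        exact hB f k
    _ = d * B := by simp

/-- The two signs give a supremum over pairs `f`, `g` involving `ψ f - ψ g`. The Lipschitz bound and
Khintchine replace this by `2 𝔼 |∑ ε (v f - v g)|`; for each `ε` the sign of the sum decides which
of `f`, `g` is charged to `Φ ε` and which to `Φ (-ε)`, and these have the same average. -/
lemma expect_iSup_add_sign_le [Nonempty T] (a ψ : T → ℝ) (v : T → Fin d → ℝ) (ha : BddAbove (Set.range a))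
    (hv : ∃ B, ∀ f k, |v f k| ≤ B)
    (hlip : ∀ f g, |ψ f - ψ g| ≤ √(∑ k, (v f k - v g k) ^ 2)) :
    𝔼 b, ⨆ f, (a f + signOf b * ψ f)
      ≤ 𝔼 ε : Fin d → Bool, ⨆ f, (a f + 2 * ∑ k, signOf (ε k) * v f k) := by
  obtain ⟨B, hB⟩ := hv
  set Φ : (Fin d → Bool) → ℝ := fun ε => ⨆ f, (a f + 2 * ∑ k, signOf (ε k) * v f k) with hΦ
  have hbdd : ∀ ε : Fin d → Bool,
      BddAbove (Set.range fun f => a f + 2 * ∑ k, signOf (ε k) * v f k) := fun ε =>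
    bddAbove_range_add_of_abs_le ha ⟨2 * (d * B), fun f => by
      rw [abs_mul, abs_of_pos (by norm_num : (0 : ℝ) < 2)]
      exact mul_le_mul_of_nonneg_left (abs_sum_signOf_mul_le hB ε f) (by norm_num)⟩
  have key : ∀ f g, (a f + ψ f) + (a g - ψ g) ≤ 2 * 𝔼 ε, Φ ε := by
    intro f g
    have h1 : ψ f - ψ g ≤ 2 * 𝔼 ε : Fin d → Bool, |∑ k, signOf (ε k) * (v f k - v g k)| :=
      (le_abs_self _).trans ((hlip f g).trans (sqrt_sum_sq_le_expect_abs _))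
    have h2 : ∀ ε : Fin d → Bool,
        a f + a g + 2 * |∑ k, signOf (ε k) * (v f k - v g k)| ≤ Φ ε + Φ (fun k => !ε k) := by
      intro ε
      have e1 : ∀ h, a h + 2 * ∑ k, signOf (ε k) * v h k ≤ Φ ε := fun h => le_ciSup (hbdd ε) h
      have e2 : ∀ h, a h - 2 * ∑ k, signOf (ε k) * v h k ≤ Φ (fun k => !ε k) := by
        intro h
        have := le_ciSup (hbdd fun k => !ε k) h
        simp only [signOf_not, neg_mul, Finset.sum_neg_distrib, mul_neg] at this
        rw [sub_eq_add_neg]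
        simpa [hΦ] using this
      have e3 : ∑ k, signOf (ε k) * (v f k - v g k)
          = ∑ k, signOf (ε k) * v f k - ∑ k, signOf (ε k) * v g k := by
        rw [← Finset.sum_sub_distrib]
        exact Finset.sum_congr rfl fun k _ => by ring
      rw [e3]
      rcases abs_cases (∑ k, signOf (ε k) * v f k - ∑ k, signOf (ε k) * v g k) with h | h <;>
        rw [h.1] <;> linarith [e1 f, e2 f, e1 g, e2 g]
    have h3 : 𝔼 ε : Fin d → Bool, (a f + a g + 2 * |∑ k, signOf (ε k) * (v f k - v g k)|)
        ≤ 𝔼 ε, (Φ ε + Φ (fun k => !ε k)) := Finset.expect_le_expect fun ε _ => h2 ε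
    simp only [Finset.expect_add_distrib, Fintype.expect_const, ← Finset.mul_expect,
      expect_neg_signs Φ] at h3
    linarith
  rw [expect_bool]
  simp only [signOf_true, signOf_false, one_mul, neg_mul, ← sub_eq_add_neg]
  have h5 : ∀ g, (⨆ f, (a f + ψ f)) ≤ 2 * (𝔼 ε, Φ ε) - (a g - ψ g) := fun g =>
    ciSup_le fun f => by linarith [key f g]
  have h6 : (⨆ g, (a g - ψ g)) ≤ 2 * (𝔼 ε, Φ ε) - ⨆ f, (a f + ψ f) :=
    ciSup_le fun g => by linarith [h5 g]
  linarith

/-- Vector contraction inequality for Rademacher averages. -/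
theorem expect_iSup_signs_le_vector [Nonempty T] {n : ℕ} (a : T → ℝ) (ψ : Fin n → T → ℝ)
    (v : Fin n → T → Fin d → ℝ) (ha : BddAbove (Set.range a))
    (hψ : ∀ i, ∃ B, ∀ f, |ψ i f| ≤ B) (hv : ∀ i, ∃ B, ∀ f k, |v i f k| ≤ B)
    (hlip : ∀ i f g, |ψ i f - ψ i g| ≤ √(∑ k, (v i f k - v i g k) ^ 2)) :
    𝔼 σ : Fin n → Bool, ⨆ f, (a f + ∑ i, signOf (σ i) * ψ i f)
      ≤ 𝔼 ε : Fin n → Fin d → Bool,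
          ⨆ f, (a f + 2 * ∑ i, ∑ k, signOf (ε i k) * v i f k) := by
  induction n generalizing a with
  | zero => simp
  | succ n ih =>
    rw [expect_fin_cons, expect_fin_cons]
    simp only [Fin.sum_univ_succ (n := n), Fin.cons_zero, Fin.cons_succ, ← add_assoc, mul_add]
    -- The points after the first are converted with the first sign frozen inside the offset `a`;
    -- the first point is then converted with the new signs frozen there.
    have h1 : ∀ b : Bool, 𝔼 σ : Fin n → Bool,
        ⨆ f, (a f + signOf b * ψ 0 f + ∑ i, signOf (σ i) * ψ i.succ f)
        ≤ 𝔼 ε : Fin n → Fin d → Bool, ⨆ f, (a f + signOf b * ψ 0 f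
            + 2 * ∑ i, ∑ k, signOf (ε i k) * v i.succ f k) := fun b =>
      ih (fun f => a f + signOf b * ψ 0 f) (fun i => ψ i.succ) (fun i => v i.succ)
        (bddAbove_range_add_of_abs_le ha <| by
          obtain ⟨B, hB⟩ := hψ 0
          exact ⟨B, fun f => by
            have : |signOf b| = 1 := by cases b <;> simp
            rw [abs_mul, this, one_mul]; exact hB f⟩)
        (fun i => hψ i.succ) (fun i => hv i.succ) (fun i => hlip i.succ)
    refine (Finset.expect_le_expect fun b _ => h1 b).trans ?_
    rw [Finset.expect_comm, Finset.expect_comm (Finset.univ : Finset (Fin d → Bool))]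
    refine Finset.expect_le_expect fun ε _ => ?_
    have h2 := expect_iSup_add_sign_le
      (fun f => a f + 2 * ∑ i, ∑ k, signOf (ε i k) * v i.succ f k) (ψ 0) (v 0)
      (bddAbove_range_add_of_abs_le ha <| by
        choose B hB using hv
        refine ⟨2 * ∑ i : Fin n, d * B i.succ, fun f => ?_⟩
        rw [abs_mul, abs_of_pos (by norm_num : (0 : ℝ) < 2)]
        refine mul_le_mul_of_nonneg_left ((Finset.abs_sum_le_sum_abs _ _).trans ?_) (by norm_num)
        exact Finset.sum_le_sum fun i _ => abs_sum_signOf_mul_le (hB i.succ) (ε i) f)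
      (hv 0) (hlip 0)
    simp only [add_right_comm _ (2 * ∑ i : Fin n, ∑ k, signOf (ε i k) * v i.succ _ k)] at h2
    exact h2

end Contraction

end SketchedKernel

/-! ### McDiarmid's inequality. -/

namespace SketchedKernel

section BoundedDifferences

variable {Z : Type*} [MeasurableSpace Z]

lemma integrable_of_abs_le {α : Type*} [MeasurableSpace α] {μ : Measure α} [IsFiniteMeasure μ]
    {f : α → ℝ} (hf : Measurable f) {B : ℝ} (hB : ∀ z, |f z| ≤ B) : Integrable f μ :=
  Integrable.of_bound hf.aestronglyMeasurable B (.of_forall hB)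

lemma abs_integral_le_of_abs_le {α : Type*} [MeasurableSpace α] {μ : Measure α}
    [IsProbabilityMeasure μ] {f : α → ℝ} {B : ℝ} (hB : ∀ z, |f z| ≤ B) : |∫ z, f z ∂μ| ≤ B := by
  simpa using norm_integral_le_of_norm_le_const (μ := μ) (f := f) (.of_forall hB)

variable (P : Measure Z) [IsProbabilityMeasure P]

lemma measurable_fin_cons {n : ℕ} :
    Measurable fun p : Z × (Fin n → Z) => (Fin.cons p.1 p.2 : Fin (n + 1) → Z) := by
  refine measurable_pi_lambda _ fun i => ?_
  refine Fin.cases ?_ (fun j => ?_) i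
  · simpa using measurable_fst
  · simp only [Fin.cons_succ]; fun_prop

lemma integral_pi_fin_succ {n : ℕ} (F : (Fin (n + 1) → Z) → ℝ) (hF : Measurable F)
    {B : ℝ} (hB : ∀ z, |F z| ≤ B) :
    ∫ z, F z ∂(Measure.pi fun _ => P)
      = ∫ a, ∫ z, F (Fin.cons a z) ∂(Measure.pi fun _ : Fin n => P) ∂P := by
  have h := (measurePreserving_piFinSuccAbove (fun _ : Fin (n + 1) => P) 0).symm
  have h1 := h.integral_comp' F
  have h2 := integral_prod (μ := P) (ν := Measure.pi fun _ : Fin n => P)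
    (fun p : Z × (Fin n → Z) => F (Fin.cons p.1 p.2))
    (integrable_of_abs_le (hF.comp measurable_fin_cons) fun p => hB _)
  rw [← h1, ← h2]
  refine integral_congr_ae (.of_forall fun p => ?_)
  simp [MeasurableEquiv.piFinSuccAbove, Fin.insertNthEquiv]

/-- Condition on the first point. The fluctuation around the conditional mean `Φ₀` is the induction
hypothesis; `Φ₀` itself takes values in an interval of length `c`, so Hoeffding's lemma contributes
one more variance proxy `(c / 2)²`. -/
lemma integral_exp_sub_le_of_bounded_differences {n : ℕ} (Φ : (Fin n → Z) → ℝ)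
    (hΦ : Measurable Φ) {B : ℝ} (hB : ∀ z, |Φ z| ≤ B) {c : ℝ}
    (hc : ∀ z i w, Φ z - Φ (Function.update z i w) ≤ c) (t : ℝ) :
    ∫ z, Real.exp (t * (Φ z - ∫ z, Φ z ∂(Measure.pi fun _ => P))) ∂(Measure.pi fun _ => P)
      ≤ Real.exp (n * (c / 2) ^ 2 * t ^ 2 / 2) := by
  induction n with
  | zero =>
    have h0 : ∀ z, Φ z = Φ Fin.elim0 := fun z => congrArg Φ (Subsingleton.elim _ _)
    simp [h0]
  | succ n ih =>
    set μ : Measure (Fin n → Z) := Measure.pi fun _ => P with hμ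
    set m := ∫ z, Φ z ∂(Measure.pi fun _ => P) with hm
    set Φ₀ : Z → ℝ := fun a => ∫ z, Φ (Fin.cons a z) ∂μ with hΦ₀
    have hcons : Measurable fun p : Z × (Fin n → Z) => Φ (Fin.cons p.1 p.2) :=
      hΦ.comp measurable_fin_cons
    have hmΦ₀ : Measurable Φ₀ := (hcons.stronglyMeasurable.integral_prod_right (ν := μ)).measurable
    have hsec : ∀ a, Measurable fun z : Fin n → Z => Φ (Fin.cons a z) := fun a =>
      hcons.comp measurable_prodMk_left
    have hBΦ₀ : ∀ a, |Φ₀ a| ≤ B := fun a => abs_integral_le_of_abs_le fun z => hB _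
    have hm' : m = ∫ a, Φ₀ a ∂P := integral_pi_fin_succ P Φ hΦ hB
    have hmB : |m| ≤ B := abs_integral_le_of_abs_le hB
    have hexp : ∀ x y : ℝ, |x| ≤ B → |y| ≤ B →
        |Real.exp (t * (x - y))| ≤ Real.exp (|t| * (2 * B)) := by
      intro x y hx hy
      rw [Real.abs_exp]
      refine Real.exp_le_exp.2 ((le_abs_self _).trans ?_)
      rw [abs_mul]
      refine mul_le_mul_of_nonneg_left ?_ (abs_nonneg _)
      exact (abs_sub _ _).trans (by linarith)
    rw [integral_pi_fin_succ P (fun z => Real.exp (t * (Φ z - m)))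
      (((hΦ.sub_const m).const_mul t).exp) fun z => hexp _ _ (hB z) hmB]
    have hinner : ∀ a, ∫ z, Real.exp (t * (Φ (Fin.cons a z) - m)) ∂μ
        ≤ Real.exp (t * (Φ₀ a - m)) * Real.exp (n * (c / 2) ^ 2 * t ^ 2 / 2) := by
      intro a
      have e : ∀ z : Fin n → Z, Real.exp (t * (Φ (Fin.cons a z) - m))
          = Real.exp (t * (Φ₀ a - m)) * Real.exp (t * (Φ (Fin.cons a z) - Φ₀ a)) := fun z => by
        rw [← Real.exp_add]; ring_nf
      simp_rw [e]
      rw [integral_const_mul]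
      refine mul_le_mul_of_nonneg_left ?_ (Real.exp_pos _).le
      refine ih (fun z => Φ (Fin.cons a z)) (hsec a) (fun z => hB _) fun z i w => ?_
      have := hc (Fin.cons a z) i.succ w
      rwa [← Fin.cons_update] at this
    have hstep : ∀ a b, Φ₀ a - Φ₀ b ≤ c := by
      intro a b
      have hi : ∀ a, Integrable (fun z : Fin n → Z => Φ (Fin.cons a z)) μ := fun a =>
        integrable_of_abs_le (hsec a) fun z => hB _
      rw [hΦ₀]
      simp only
      rw [← integral_sub (hi a) (hi b)]
      have : ∫ z, (Φ (Fin.cons a z) - Φ (Fin.cons b z)) ∂μ ≤ ∫ _z, c ∂μ := by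
        refine integral_mono ((hi a).sub (hi b)) (integrable_const _) fun z => ?_
        have := hc (Fin.cons a z) 0 b
        rwa [Fin.update_cons_zero] at this
      simpa using this
    have : Nonempty Z := (Measure.nonempty_of_neZero P)
    have hbdd : BddBelow (Set.range Φ₀) := ⟨-B, by
      rintro _ ⟨a, rfl⟩; exact (abs_le.1 (hBΦ₀ a)).1⟩
    have hIcc : ∀ a, Φ₀ a ∈ Set.Icc (⨅ b, Φ₀ b) ((⨅ b, Φ₀ b) + c) := fun a =>
      ⟨ciInf_le hbdd a, by
        have : Φ₀ a - c ≤ ⨅ b, Φ₀ b := le_ciInf fun b => by linarith [hstep a b]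
        linarith⟩
    have hH := (hasSubgaussianMGF_of_mem_Icc (μ := P) hmΦ₀.aemeasurable
      (.of_forall hIcc)).mgf_le t
    rw [← hm'] at hH
    simp only [mgf, add_sub_cancel_left] at hH
    have hint : Integrable (fun a => Real.exp (t * (Φ₀ a - m))
        * Real.exp (n * (c / 2) ^ 2 * t ^ 2 / 2)) P :=
      (integrable_of_abs_le (((hmΦ₀.sub_const m).const_mul t).exp)
        fun a => hexp _ _ (hBΦ₀ a) hmB).mul_const _
    refine (integral_mono_of_nonneg (.of_forall fun a => ?_) hint (.of_forall hinner)).trans ?_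
    · exact integral_nonneg fun z => (Real.exp_pos _).le
    rw [integral_mul_const]
    refine (mul_le_mul_of_nonneg_right hH (Real.exp_pos _).le).trans ?_
    rw [← Real.exp_add]
    refine Real.exp_le_exp.2 (le_of_eq ?_)
    push_cast
    rw [Real.norm_eq_abs, div_pow, sq_abs]
    ring

/-- McDiarmid's bounded differences inequality. -/
theorem measureReal_ge_le_of_bounded_differences {n : ℕ} (Φ : (Fin n → Z) → ℝ)
    (hΦ : Measurable Φ) {B : ℝ} (hB : ∀ z, |Φ z| ≤ B) {c : ℝ}
    (hc : ∀ z i w, Φ z - Φ (Function.update z i w) ≤ c) {ε : ℝ} (hε : 0 ≤ ε) :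
    (Measure.pi fun _ => P).real {z | ε ≤ Φ z - ∫ z, Φ z ∂(Measure.pi fun _ => P)}
      ≤ Real.exp (-ε ^ 2 / (2 * (n * (c / 2) ^ 2))) := by
  set m := ∫ z, Φ z ∂(Measure.pi fun _ => P) with hm
  have hmB : |m| ≤ B := abs_integral_le_of_abs_le hB
  have h : HasSubgaussianMGF (fun z => Φ z - m) (Real.toNNReal (n * (c / 2) ^ 2))
      (Measure.pi fun _ => P) := by
    refine ⟨fun t => ?_, fun t => ?_⟩
    · refine integrable_of_abs_le (B := Real.exp (|t| * (2 * B)))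
        (((hΦ.sub_const m).const_mul t).exp) fun z => ?_
      rw [Real.abs_exp]
      refine Real.exp_le_exp.2 ((le_abs_self _).trans ?_)
      rw [abs_mul]
      refine mul_le_mul_of_nonneg_left ?_ (abs_nonneg _)
      exact (abs_sub _ _).trans (by linarith [hB z])
    · rw [Real.coe_toNNReal _ (by positivity)]
      exact integral_exp_sub_le_of_bounded_differences P Φ hΦ hB hc t
  have := h.measure_ge_le hε
  rwa [Real.coe_toNNReal _ (by positivity)] at this

end BoundedDifferences

end SketchedKernel

/-! ### Linear algebra of satisfiable sketches. -/

namespace SketchedKernel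

open Matrix

lemma norm_toLp_sq {m : Type*} [Fintype m] (v : m → ℝ) :
    ‖WithLp.toLp 2 v‖ ^ 2 = ∑ i, v i ^ 2 := by
  simp [EuclideanSpace.norm_sq_eq]

lemma norm_toLp_sq_eq_dotProduct {m : Type*} [Fintype m] (v : m → ℝ) :
    ‖WithLp.toLp 2 v‖ ^ 2 = v ⬝ᵥ v := by
  rw [norm_toLp_sq, dotProduct]
  exact Finset.sum_congr rfl fun i _ => by ring

lemma dotProduct_le_norm_mul_norm {m : Type*} [Fintype m] (v w : m → ℝ) :
    v ⬝ᵥ w ≤ ‖WithLp.toLp 2 v‖ * ‖WithLp.toLp 2 w‖ := by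
  have h := real_inner_le_norm (WithLp.toLp 2 v) (WithLp.toLp 2 w)
  have e : inner ℝ (WithLp.toLp 2 v) (WithLp.toLp 2 w) = v ⬝ᵥ w := by
    simp [PiLp.inner_apply, dotProduct, mul_comm]
  rwa [e] at h

section OpNorm

variable {m p : Type*} [Fintype m] [Fintype p] [DecidableEq p]

lemma opNorm_nonneg (A : Matrix m p ℝ) : 0 ≤ opNorm A := norm_nonneg _

lemma norm_mulVec_le (A : Matrix m p ℝ) (v : p → ℝ) :
    ‖WithLp.toLp 2 (A *ᵥ v)‖ ≤ opNorm A * ‖WithLp.toLp 2 v‖ :=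
  (LinearMap.toContinuousLinearMap (Matrix.toEuclideanLin A)).le_opNorm (WithLp.toLp 2 v)

lemma norm_transpose_mulVec_le (A : Matrix m p ℝ) (v : m → ℝ) :
    ‖WithLp.toLp 2 (Aᵀ *ᵥ v)‖ ≤ opNorm A * ‖WithLp.toLp 2 v‖ := by
  have h1 : ‖WithLp.toLp 2 (Aᵀ *ᵥ v)‖ ^ 2
      ≤ opNorm A * ‖WithLp.toLp 2 (Aᵀ *ᵥ v)‖ * ‖WithLp.toLp 2 v‖ := by
    rw [norm_toLp_sq_eq_dotProduct, mulVec_transpose, ← dotProduct_mulVec, ← mulVec_transpose,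
      dotProduct_comm]
    exact (dotProduct_le_norm_mul_norm _ _).trans
      (mul_le_mul_of_nonneg_right (norm_mulVec_le A _) (norm_nonneg _))
  rcases (norm_nonneg (WithLp.toLp 2 (Aᵀ *ᵥ v))).eq_or_lt with h | h
  · rw [← h]; exact mul_nonneg (opNorm_nonneg A) (norm_nonneg _)
  · nlinarith

/-- If `AᵀA` is within `1/2` of the identity, then `Aᵀα = q` has a solution `α` with
`‖α‖ ≤ √2 ‖q‖`. -/
lemma exists_transpose_mulVec_eq (A : Matrix m p ℝ) (hA : opNorm (Aᵀ * A - 1) ≤ 1 / 2)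
    (q : p → ℝ) :
    ∃ α : m → ℝ, Aᵀ *ᵥ α = q ∧ ‖WithLp.toLp 2 α‖ ≤ √2 * ‖WithLp.toLp 2 q‖ := by
  -- From `‖u‖ ≤ ‖AᵀA u‖ + ‖u‖ / 2`: the Gram matrix is invertible with inverse of norm at most `2`.
  have hlow : ∀ u : p → ℝ, ‖WithLp.toLp 2 u‖ ≤ 2 * ‖WithLp.toLp 2 ((Aᵀ * A) *ᵥ u)‖ := by
    intro u
    have h1 := norm_mulVec_le (Aᵀ * A - 1) u
    have h2 : WithLp.toLp 2 u = WithLp.toLp 2 ((Aᵀ * A) *ᵥ u)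
        - WithLp.toLp 2 ((Aᵀ * A - 1) *ᵥ u) := by
      rw [sub_mulVec, one_mulVec, WithLp.toLp_sub]; abel
    have h3 : ‖WithLp.toLp 2 u‖ ≤ ‖WithLp.toLp 2 ((Aᵀ * A) *ᵥ u)‖
        + ‖WithLp.toLp 2 ((Aᵀ * A - 1) *ᵥ u)‖ := by
      conv_lhs => rw [h2]
      exact norm_sub_le _ _
    have h4 := mul_le_mul_of_nonneg_right hA (norm_nonneg (WithLp.toLp 2 u))
    linarith
  have hinj : Function.Injective (Matrix.mulVecLin (Aᵀ * A)) := by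
    rw [injective_iff_map_eq_zero]
    intro u hu
    have h := hlow u
    rw [Matrix.mulVecLin_apply] at hu
    rw [hu, WithLp.toLp_zero, norm_zero, mul_zero] at h
    have h0 : WithLp.toLp 2 u = 0 := norm_le_zero_iff.1 h
    simpa using congrArg WithLp.ofLp h0
  obtain ⟨u, hu⟩ := LinearMap.surjective_of_injective hinj q
  rw [Matrix.mulVecLin_apply] at hu
  -- The solution `A (AᵀA)⁻¹ q`: its squared norm is `⟨q, u⟩ ≤ 2 ‖q‖²`, better than the bound
  -- through `‖A‖ ‖u‖`.
  refine ⟨A *ᵥ u, by rw [mulVec_mulVec, hu], ?_⟩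
  have h1 := hlow u
  rw [hu] at h1
  have h2 : ‖WithLp.toLp 2 (A *ᵥ u)‖ ^ 2 ≤ 2 * ‖WithLp.toLp 2 q‖ ^ 2 := by
    rw [norm_toLp_sq_eq_dotProduct, dotProduct_mulVec, ← mulVec_transpose, mulVec_mulVec, hu]
    nlinarith [dotProduct_le_norm_mul_norm q u, norm_nonneg (WithLp.toLp 2 q)]
  refine le_of_sq_le_sq ?_ (by positivity)
  rw [mul_pow, Real.sq_sqrt (by norm_num)]
  exact h2

end OpNorm

section Eigen

variable {n s : ℕ} {A U : Matrix (Fin n) (Fin n) ℝ} {ev : Fin n → ℝ}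

lemma criticalRadius_nonneg (ev : Fin n → ℝ) : 0 ≤ criticalRadius ev :=
  Real.sInf_nonneg fun _ hr => hr.1.le

lemma ev_le_of_statDim_le (hev : Antitone ev) (i : Fin n) (hi : statDim ev ≤ (i : ℕ)) :
    ev i ≤ criticalRadius ev ^ 2 := by
  have hmem : statDim ev ∈ ({j : ℕ | ∃ i : Fin n, j = (i : ℕ) + 1 ∧
      ev i ≤ criticalRadius ev ^ 2} ∪ {n}) := Nat.sInf_mem ⟨n, Or.inr rfl⟩
  rcases hmem with ⟨j, hj, hle⟩ | h
  -- `statDim` counts from one: here it equals `j + 1`, so `statDim ev ≤ i` puts `i` strictly after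
  -- `j`, and monotonicity applies.
  · refine (hev ?_).trans hle
    rw [Fin.le_def]
    omega
  · have h' : statDim ev = n := h
    have := i.2
    omega

lemma IsEigendecomposition.apply_eq (h : IsEigendecomposition A U ev) (i j : Fin n) :
    A i j = ∑ l, ev l * U i l * U j l := by
  rw [h.eq_mul, Matrix.mul_apply]
  refine Finset.sum_congr rfl fun l _ => ?_
  rw [Matrix.mul_diagonal, Matrix.transpose_apply]
  ring

lemma IsEigendecomposition.transpose_mul (h : IsEigendecomposition A U ev) : Uᵀ * U = 1 := by
  have := h.orthogonal
  rw [Matrix.mem_orthogonalGroup_iff'] at this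
  simpa [Matrix.star_eq_conjTranspose] using this

lemma IsEigendecomposition.mul_transpose (h : IsEigendecomposition A U ev) : U * Uᵀ = 1 := by
  have := h.orthogonal
  rw [Matrix.mem_orthogonalGroup_iff] at this
  simpa [Matrix.star_eq_conjTranspose] using this

lemma IsEigendecomposition.norm_transpose_mulVec (h : IsEigendecomposition A U ev)
    (v : Fin n → ℝ) : ‖WithLp.toLp 2 (Uᵀ *ᵥ v)‖ = ‖WithLp.toLp 2 v‖ := by
  rw [← sq_eq_sq₀ (norm_nonneg _) (norm_nonneg _), norm_toLp_sq_eq_dotProduct,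
    norm_toLp_sq_eq_dotProduct, mulVec_transpose, ← dotProduct_mulVec, ← mulVec_transpose,
    mulVec_mulVec, h.mul_transpose, one_mulVec]

lemma IsEigendecomposition.ev_nonneg (h : IsEigendecomposition A U ev)
    (hA : ∀ a : Fin n → ℝ, 0 ≤ ∑ i, ∑ j, a i * A i j * a j) (l : Fin n) : 0 ≤ ev l := by
  have h1 := hA fun i => U i l
  have h2 : ∑ i, ∑ j, U i l * A i j * U j l = (Uᵀ * A * U) l l := by
    rw [Matrix.mul_apply, Finset.sum_comm]
    refine Finset.sum_congr rfl fun j _ => ?_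
    rw [Matrix.mul_apply, Finset.sum_mul]
    rfl
  have h3 : Uᵀ * A * U = Matrix.diagonal ev := by
    rw [h.eq_mul]
    calc Uᵀ * (U * diagonal ev * Uᵀ) * U = (Uᵀ * U) * diagonal ev * (Uᵀ * U) := by
          simp only [Matrix.mul_assoc]
      _ = diagonal ev := by rw [h.transpose_mul, Matrix.one_mul, Matrix.mul_one]
  rw [h2, h3, Matrix.diagonal_apply_eq] at h1
  exact h1

/-- Every vector is, up to an error of order `criticalRadius` in the seminorm of the Gram matrix, in
the row space of a satisfiable sketch. -/
lemma IsSatisfiable.exists_sum_ev_mul_sq_le {c : ℝ} (hc : 0 < c) {S : Matrix (Fin s) (Fin n) ℝ}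
    (h : IsEigendecomposition A U ev) (hev : ∀ l, 0 ≤ ev l) (hS : IsSatisfiable c U ev S)
    (v : Fin n → ℝ) :
    ∃ α : Fin s → ℝ, ∑ l, ev l * (Uᵀ *ᵥ (v - Sᵀ *ᵥ α)) l ^ 2
      ≤ ((1 + √6 * c) * criticalRadius ev) ^ 2 * ∑ i, v i ^ 2 := by
  set δ := criticalRadius ev with hδ
  have hδ0 : 0 ≤ δ := criticalRadius_nonneg ev
  set r := statDim ev with hr
  set p : Fin n → ℝ := Uᵀ *ᵥ v with hp
  have hpv : ‖WithLp.toLp 2 p‖ = ‖WithLp.toLp 2 v‖ := h.norm_transpose_mulVec v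
  set p₁ : {i : Fin n // (i : ℕ) < r} → ℝ := fun i => p i.1 with hp₁
  set p₂ : {i : Fin n // r ≤ (i : ℕ)} → ℝ := fun i => p i.1 with hp₂
  have hsub : ∀ (q : Fin n → Prop) [DecidablePred q] (F : Fin n → ℝ), (∀ i, 0 ≤ F i) →
      ∑ i : {i // q i}, F i.1 ≤ ∑ i, F i := by
    intro q _ F hF
    rw [← Fintype.sum_subtype_add_sum_subtype q F]
    exact le_add_of_nonneg_right (Finset.sum_nonneg fun i _ => hF i)
  have hp1v : ‖WithLp.toLp 2 p₁‖ ≤ ‖WithLp.toLp 2 v‖ := by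
    rw [← hpv]
    refine le_of_sq_le_sq ?_ (norm_nonneg _)
    rw [norm_toLp_sq, norm_toLp_sq]
    exact hsub _ (fun i => p i ^ 2) fun i => sq_nonneg _
  have hp2v : ‖WithLp.toLp 2 p₂‖ ≤ ‖WithLp.toLp 2 v‖ := by
    rw [← hpv]
    refine le_of_sq_le_sq ?_ (norm_nonneg _)
    rw [norm_toLp_sq, norm_toLp_sq]
    exact hsub _ (fun i => p i ^ 2) fun i => sq_nonneg _
  -- This `α` reproduces the first `r` coordinates of `Uᵀ v` exactly, so only the tail contributes
  -- to the error: `δ ‖v‖` from `v` itself and `c δ ‖α‖` from the sketch.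
  obtain ⟨α, hα, hαn⟩ := exists_transpose_mulVec_eq (S * leftBlock U r) hS.isometry p₁
  refine ⟨α, ?_⟩
  have hleft : ∀ l : Fin n, (l : ℕ) < r → (Uᵀ *ᵥ (v - Sᵀ *ᵥ α)) l = 0 := by
    intro l hl
    have h1 := congrFun hα ⟨l, hl⟩
    rw [Matrix.transpose_mul, ← mulVec_mulVec] at h1
    rw [mulVec_sub, Pi.sub_apply, sub_eq_zero]
    exact h1.symm
  set D := sqrtRightDiag ev r with hD
  have hDt : Dᵀ = D := by rw [hD, sqrtRightDiag, Matrix.diagonal_transpose]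
  have hright : ∀ l : {i : Fin n // r ≤ (i : ℕ)},
      (D *ᵥ p₂ - (S * rightBlock U r * D)ᵀ *ᵥ α) l
        = √(ev l.1) * (Uᵀ *ᵥ (v - Sᵀ *ᵥ α)) l.1 := by
    intro l
    have h1 : ((rightBlock U r)ᵀ *ᵥ (Sᵀ *ᵥ α)) l = (Uᵀ *ᵥ (Sᵀ *ᵥ α)) l.1 := rfl
    rw [Matrix.transpose_mul, Matrix.transpose_mul, hDt, ← mulVec_mulVec, ← mulVec_mulVec,
      Pi.sub_apply, hD, sqrtRightDiag, mulVec_diagonal, mulVec_diagonal, h1, mulVec_sub,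
      Pi.sub_apply]
    ring
  have hsum : ∑ l, ev l * (Uᵀ *ᵥ (v - Sᵀ *ᵥ α)) l ^ 2
      = ‖WithLp.toLp 2 (D *ᵥ p₂ - (S * rightBlock U r * D)ᵀ *ᵥ α)‖ ^ 2 := by
    rw [norm_toLp_sq]
    simp_rw [hright, mul_pow, Real.sq_sqrt (hev _)]
    rw [← Fintype.sum_subtype_add_sum_subtype (fun l : Fin n => r ≤ (l : ℕ))
      (fun l => ev l * (Uᵀ *ᵥ (v - Sᵀ *ᵥ α)) l ^ 2)]
    rw [add_eq_left]
    exact Finset.sum_eq_zero fun l _ => by rw [hleft l.1 (not_le.1 l.2)]; ring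
  have hDp : ‖WithLp.toLp 2 (D *ᵥ p₂)‖ ≤ δ * ‖WithLp.toLp 2 p₂‖ := by
    refine le_of_sq_le_sq ?_ (by positivity)
    rw [mul_pow, norm_toLp_sq, norm_toLp_sq, Finset.mul_sum]
    refine Finset.sum_le_sum fun l _ => ?_
    rw [hD, sqrtRightDiag, mulVec_diagonal, mul_pow, Real.sq_sqrt (hev _)]
    exact mul_le_mul_of_nonneg_right (ev_le_of_statDim_le h.antitone l.1 l.2) (sq_nonneg _)
  have hSa : ‖WithLp.toLp 2 ((S * rightBlock U r * D)ᵀ *ᵥ α)‖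
      ≤ c * δ * ‖WithLp.toLp 2 α‖ :=
    (norm_transpose_mulVec_le _ _).trans
      (mul_le_mul_of_nonneg_right hS.tail (norm_nonneg _))
  -- The argument gives `1 + √2 c`; it is relaxed to the stated constant.
  have h26 : √2 ≤ √6 := Real.sqrt_le_sqrt (by norm_num)
  have hfin : ‖WithLp.toLp 2 (D *ᵥ p₂ - (S * rightBlock U r * D)ᵀ *ᵥ α)‖
      ≤ (1 + √6 * c) * δ * ‖WithLp.toLp 2 v‖ := by
    rw [WithLp.toLp_sub]
    refine (norm_sub_le _ _).trans ?_
    have h1 : ‖WithLp.toLp 2 α‖ ≤ √6 * ‖WithLp.toLp 2 v‖ :=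
      hαn.trans (mul_le_mul h26 hp1v (norm_nonneg _) (Real.sqrt_nonneg _))
    calc _ ≤ δ * ‖WithLp.toLp 2 v‖ + c * δ * (√6 * ‖WithLp.toLp 2 v‖) :=
          add_le_add (hDp.trans (mul_le_mul_of_nonneg_left hp2v hδ0))
            (hSa.trans (mul_le_mul_of_nonneg_left h1 (by positivity)))
      _ = _ := by ring
  rw [hsum, ← norm_toLp_sq, ← mul_pow]
  exact pow_le_pow_left₀ (norm_nonneg _) hfin 2

end Eigen

end SketchedKernel

/-! ### The vector-valued RKHS and approximation by sketched functions. -/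

namespace SketchedKernel

open Matrix RKHS

lemma exists_orthogonal_projection_range {V H : Type*} [AddCommGroup V] [Module ℝ V]
    [FiniteDimensional ℝ V] [NormedAddCommGroup H] [InnerProductSpace ℝ H] (T : V →ₗ[ℝ] H)
    (f : H) :
    ∃ c, ‖T c‖ ≤ ‖f‖ ∧ ‖f - T c‖ ≤ ‖f‖ ∧ ∀ c', inner ℝ (f - T c) (T c') = 0 := by
  have hmem := ((LinearMap.range T).orthogonalProjectionOnto f).2
  obtain ⟨c, hc⟩ := hmem
  have horth : ∀ c', inner ℝ (f - T c) (T c') = 0 := by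
    intro c'
    rw [hc]
    exact (LinearMap.range T).starProjection_inner_eq_zero f (T c') ⟨c', rfl⟩
  have hpy : ‖f‖ ^ 2 = ‖f - T c‖ ^ 2 + ‖T c‖ ^ 2 := by
    have := norm_add_sq_real (f - T c) (T c)
    rw [horth c, sub_add_cancel] at this
    linarith
  refine ⟨c, ?_, ?_, horth⟩
  · exact le_of_sq_le_sq (by nlinarith [sq_nonneg ‖f - T c‖]) (norm_nonneg _)
  · exact le_of_sq_le_sq (by nlinarith [sq_nonneg ‖T c‖]) (norm_nonneg _)

section RKHS

variable {X : Type*} {d : ℕ} {H : Type*} [NormedAddCommGroup H]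
  [InnerProductSpace ℝ H] [RKHS ℝ H X (EuclideanSpace ℝ (Fin d))]
  {k : X → X → ℝ} {M : Matrix (Fin d) (Fin d) ℝ}

lemma sum_apply {ι : Type*} (s : Finset ι) (f : ι → H) (x : X) :
    (∑ i ∈ s, f i : H) x = ∑ i ∈ s, f i x := by
  have h := map_sum (RKHS.coeCLM ℝ (H := H)) f s
  have h2 := congrFun h x
  rw [Finset.sum_apply] at h2
  exact h2

variable [CompleteSpace H]

lemma norm_toEuclideanCLM_eq_opNorm (M : Matrix (Fin d) (Fin d) ℝ) :
    ‖Matrix.toEuclideanCLM (𝕜 := ℝ) M‖ = opNorm M := rfl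

lemma HasDecomposableKernel.kerFun_apply (hH : HasDecomposableKernel H k M) (x x' : X)
    (v : EuclideanSpace ℝ (Fin d)) :
    kerFun H x' v x = k x x' • Matrix.toEuclideanCLM (𝕜 := ℝ) M v := by
  rw [RKHS.kerFun_apply, hH.kernel_eq]; rfl

lemma HasDecomposableKernel.inner_kerFun_kerFun (hH : HasDecomposableKernel H k M) (x x' : X)
    (u v : EuclideanSpace ℝ (Fin d)) :
    inner ℝ (kerFun H x u) (kerFun H x' v)
      = k x x' * inner ℝ u (Matrix.toEuclideanCLM (𝕜 := ℝ) M v) := by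
  rw [kerFun_inner, hH.kerFun_apply, inner_smul_right]

lemma HasDecomposableKernel.norm_sq_sum_kerFun (hH : HasDecomposableKernel H k M) {ι : Type*}
    [Fintype ι] (w : ι → X) (c : ι → EuclideanSpace ℝ (Fin d)) :
    ‖∑ i, kerFun H (w i) (c i)‖ ^ 2
      = ∑ i, ∑ j, k (w i) (w j) * inner ℝ (c i) (Matrix.toEuclideanCLM (𝕜 := ℝ) M (c j)) := by
  rw [← real_inner_self_eq_norm_sq, sum_inner]
  refine Finset.sum_congr rfl fun i _ => ?_
  rw [inner_sum]
  exact Finset.sum_congr rfl fun j _ => hH.inner_kerFun_kerFun _ _ _ _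

lemma IsScalarKernel.diag_nonneg (hk : IsScalarKernel k) (x : X) : 0 ≤ k x x := by
  simpa using hk.nonneg 1 (fun _ => x) (fun _ => 1)

/-- The source of `Tr M` in the rates: contraction produces independent signs per output coordinate,
so the diagonal entries of `M` are summed. -/
lemma HasDecomposableKernel.sum_norm_kerFun_basis_sq (hH : HasDecomposableKernel H k M) (x : X) :
    ∑ a, ‖kerFun H x (EuclideanSpace.single a (1 : ℝ))‖ ^ 2 = k x x * M.trace := by
  rw [Matrix.trace, Finset.mul_sum]
  refine Finset.sum_congr rfl fun a _ => ?_
  rw [← real_inner_self_eq_norm_sq, hH.inner_kerFun_kerFun]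
  congr 1
  simp [EuclideanSpace.inner_single_left, Matrix.ofLp_toEuclideanCLM]

lemma HasDecomposableKernel.norm_apply_le (hH : HasDecomposableKernel H k M) (f : H) (x : X) :
    ‖f x‖ ≤ ‖f‖ * √(k x x * opNorm M) := by
  refine (RKHS.norm_apply_le f x).trans (le_of_eq ?_)
  rw [hH.kernel_eq, norm_smul, norm_toEuclideanCLM_eq_opNorm, Real.norm_of_nonneg
    (hH.scalar.diag_nonneg x)]

/-- The linear map sending coefficients to the corresponding combination of kernel functions. -/
def kerComb (H : Type*) [NormedAddCommGroup H]
    [InnerProductSpace ℝ H] [CompleteSpace H] [RKHS ℝ H X (EuclideanSpace ℝ (Fin d))]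
    {ι : Type*} [Fintype ι] (w : ι → X) : (ι → EuclideanSpace ℝ (Fin d)) →ₗ[ℝ] H where
  toFun c := ∑ i, kerFun H (w i) (c i)
  map_add' c c' := by simp [Finset.sum_add_distrib]
  map_smul' r c := by simp [Finset.smul_sum]

lemma kerComb_def {ι : Type*} [Fintype ι] (w : ι → X) (c : ι → EuclideanSpace ℝ (Fin d)) :
    kerComb H w c = ∑ i, kerFun H (w i) (c i) := rfl

lemma HasDecomposableKernel.kerComb_apply (hH : HasDecomposableKernel H k M) {ι : Type*}
    [Fintype ι] (w : ι → X) (c : ι → EuclideanSpace ℝ (Fin d)) (x : X) :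
    kerComb H w c x = ∑ i, k x (w i) • Matrix.toEuclideanCLM (𝕜 := ℝ) M (c i) := by
  rw [kerComb_def, sum_apply]
  exact Finset.sum_congr rfl fun i _ => hH.kerFun_apply _ _ _

/-- Every `f` agrees on finitely many points with a combination of kernel functions at these points
whose norm is at most that of `f`. -/
lemma exists_kerComb_eq {ι : Type*} [Fintype ι] (w : ι → X) (f : H) :
    ∃ c, ‖kerComb H w c‖ ≤ ‖f‖ ∧ ∀ i, kerComb H w c (w i) = f (w i) := by
  classical
  obtain ⟨c, hc, -, horth⟩ := exists_orthogonal_projection_range (kerComb H w) f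
  refine ⟨c, hc, fun i => ?_⟩
  refine ext_inner_right ℝ fun v => ?_
  -- Orthogonality of the projection error to `kerFun H (w i) v`, for all `v`, says that the error
  -- vanishes at `w i`.
  have h := horth (Pi.single i v)
  have e : kerComb H w (Pi.single i v) = kerFun H (w i) v := by
    rw [kerComb_def, Finset.sum_eq_single i]
    · simp
    · intro j _ hj; simp [hj]
    · simp
  rw [e, inner_sub_left, sub_eq_zero, inner_kerFun, inner_kerFun] at h
  exact h.symm

/-- Kernel sections are measurable and their span is dense; norm limits in an RKHS are pointwise
limits. -/
lemma HasDecomposableKernel.measurable_coe [MeasurableSpace X]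
    (hH : HasDecomposableKernel H k M) (hk : Measurable fun p : X × X => k p.1 p.2) (f : H) :
    Measurable fun x => f x := by
  have hcl : f ∈ (Submodule.span ℝ {kerFun H x v | (x) (v)}).topologicalClosure := by
    rw [RKHS.kerFun_dense]; trivial
  have hspan : ∀ g ∈ Submodule.span ℝ {kerFun H x v | (x) (v)}, Measurable fun x => g x := by
    intro g hg
    induction hg using Submodule.span_induction with
    | mem g hg =>
      obtain ⟨x', v, rfl⟩ := hg
      simp_rw [hH.kerFun_apply]
      exact (hk.comp (measurable_id.prodMk measurable_const)).smul_const _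
    | zero => simp
    | add g g' _ _ h h' => rw [RKHS.coe_add]; exact h.add h'
    | smul c g _ h => rw [RKHS.coe_smul]; exact h.const_smul c
  rw [← SetLike.mem_coe, Submodule.topologicalClosure_coe, mem_closure_iff_seq_limit] at hcl
  obtain ⟨g, hg, hlim⟩ := hcl
  refine measurable_of_tendsto_metrizable (fun i => hspan (g i) (hg i)) ?_
  rw [tendsto_pi_nhds]
  exact fun x => ((RKHS.continuous_eval x).tendsto f).comp hlim

section Sketch

variable {n s : ℕ}

/-- `sketchedFun` as a linear map of the parameter. -/
def sketchedFunLin (H : Type*) [NormedAddCommGroup H]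
    [InnerProductSpace ℝ H] [CompleteSpace H] [RKHS ℝ H X (EuclideanSpace ℝ (Fin d))]
    (x : Fin n → X) (S : Matrix (Fin s) (Fin n) ℝ) : Matrix (Fin s) (Fin d) ℝ →ₗ[ℝ] H where
  toFun Γ := sketchedFun H x S Γ
  map_add' Γ Γ' := by
    simp only [sketchedFun, Matrix.mul_add, ← Finset.sum_add_distrib, ← map_add]
    rfl
  map_smul' r Γ := by
    simp only [sketchedFun, Matrix.mul_smul, Finset.smul_sum, ← map_smul]
    rfl

lemma HasDecomposableKernel.sketchedFun_apply (hH : HasDecomposableKernel H k M)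
    (x : Fin n → X) (S : Matrix (Fin s) (Fin n) ℝ) (Γ : Matrix (Fin s) (Fin d) ℝ) (i : Fin n) :
    sketchedFun H x S Γ (x i) = WithLp.toLp 2 ((gram k x * Sᵀ * Γ * M) i) := by
  rw [sketchedFun, sum_apply]
  ext a
  rw [WithLp.ofLp_sum, Finset.sum_apply]
  simp only [hH.kerFun_apply]
  rw [Matrix.mul_assoc, Matrix.mul_assoc, Matrix.mul_apply]
  refine Finset.sum_congr rfl fun j _ => ?_
  -- Symmetry of `M` reconciles multiplication on the right of the rows with its action on vectors.
  have hsymm : ∀ b, M a b = M b a := fun b => by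
    simpa using congrFun (congrFun hH.posSemidef.1 b) a
  simp only [gram, Matrix.of_apply, PiLp.smul_apply, smul_eq_mul, Matrix.ofLp_toEuclideanCLM,
    Matrix.mulVec, dotProduct]
  congr 1
  rw [← Matrix.mul_assoc, Matrix.mul_apply]
  exact Finset.sum_congr rfl fun b _ => by rw [hsymm, mul_comm]

lemma HasDecomposableKernel.trace_eq_norm_sq (hH : HasDecomposableKernel H k M)
    (x : Fin n → X) (S : Matrix (Fin s) (Fin n) ℝ) (Γ : Matrix (Fin s) (Fin d) ℝ) :
    (S * gram k x * Sᵀ * Γ * M * Γᵀ).trace = ‖sketchedFun H x S Γ‖ ^ 2 := by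
  have h1 : S * gram k x * Sᵀ * Γ * M * Γᵀ = S * (gram k x * Sᵀ * Γ * M * Γᵀ) := by
    simp only [Matrix.mul_assoc]
  have h2 : gram k x * Sᵀ * Γ * M * Γᵀ * S = (gram k x * Sᵀ * Γ * M) * (Sᵀ * Γ)ᵀ := by
    rw [Matrix.transpose_mul, Matrix.transpose_transpose, Matrix.mul_assoc _ Γᵀ S]
  rw [h1, Matrix.trace_mul_comm, h2, ← real_inner_self_eq_norm_sq]
  conv_rhs => rw [sketchedFun, sum_inner]
  rw [Matrix.trace]
  refine Finset.sum_congr rfl fun i _ => ?_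
  change _ = inner ℝ (kerFun H (x i) (WithLp.toLp 2 ((Sᵀ * Γ) i))) (sketchedFun H x S Γ)
  rw [kerFun_inner, hH.sketchedFun_apply, Matrix.diag_apply, Matrix.mul_apply]
  simp [PiLp.inner_apply]

lemma HasDecomposableKernel.sketchedObjective_eq (hH : HasDecomposableKernel H k M)
    (ℓ : EuclideanSpace ℝ (Fin d) → EuclideanSpace ℝ (Fin d) → ℝ) (lam : ℝ)
    (x : Fin n → X) (y : Fin n → EuclideanSpace ℝ (Fin d)) (S : Matrix (Fin s) (Fin n) ℝ)
    (Γ : Matrix (Fin s) (Fin d) ℝ) :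
    sketchedObjective ℓ lam (gram k x) M y S Γ
      = (1 / (n : ℝ)) * ∑ i, ℓ (sketchedFun H x S Γ (x i)) (y i)
        + lam / 2 * ‖sketchedFun H x S Γ‖ ^ 2 := by
  rw [sketchedObjective, hH.trace_eq_norm_sq]
  simp_rw [hH.sketchedFun_apply]

/-- In the seminorm of the sample, a satisfiable sketch approximates every function by its
projection onto the sketched functions. -/
theorem HasDecomposableKernel.exists_sketchedFun_approx (hH : HasDecomposableKernel H k M)
    (hn : 0 < n) {c : ℝ} (hc : 0 < c) (x : Fin n → X) {U : Matrix (Fin n) (Fin n) ℝ}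
    {ev : Fin n → ℝ} (hU : IsEigendecomposition ((n : ℝ)⁻¹ • gram k x) U ev)
    {S : Matrix (Fin s) (Fin n) ℝ} (hS : IsSatisfiable c U ev S) (f : H) (hf : ‖f‖ ≤ 1) :
    ∃ Γ, ‖sketchedFun H x S Γ‖ ≤ 1 ∧
      ∑ i, ‖sketchedFun H x S Γ (x i) - f (x i)‖ ^ 2
        ≤ n * ((1 + √6 * c) ^ 2 * (opNorm M * criticalRadius ev ^ 2)) := by
  have hn' : (0 : ℝ) < n := Nat.cast_pos.2 hn
  have hev : ∀ l, 0 ≤ ev l := hU.ev_nonneg fun a => by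
    have h := hH.scalar.nonneg n x a
    have e : ∑ i, ∑ j, a i * ((n : ℝ)⁻¹ • gram k x) i j * a j
        = (n : ℝ)⁻¹ * ∑ i, ∑ j, a i * k (x i) (x j) * a j := by
      simp only [Finset.mul_sum, gram, Matrix.smul_apply, Matrix.of_apply, smul_eq_mul]
      exact Finset.sum_congr rfl fun i _ => Finset.sum_congr rfl fun j _ => by ring
    rw [e]
    positivity
  obtain ⟨Γ, hΓ, hp, horth⟩ := exists_orthogonal_projection_range (sketchedFunLin H x S) f
  change ‖sketchedFun H x S Γ‖ ≤ ‖f‖ at hΓ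
  set g : H := sketchedFun H x S Γ with hg
  change ‖f - g‖ ≤ ‖f‖ at hp
  refine ⟨Γ, hΓ.trans hf, ?_⟩
  set p : H := f - g with hpdef
  have hpx : ∀ i, ‖g (x i) - f (x i)‖ ^ 2 = ‖p (x i)‖ ^ 2 := fun i => by
    rw [hpdef, RKHS.coe_sub, Pi.sub_apply, norm_sub_rev]
  change ∑ i, ‖g (x i) - f (x i)‖ ^ 2 ≤ _
  simp_rw [hpx]
  set Tsum := ∑ i, ‖p (x i)‖ ^ 2 with hT
  have hT0 : 0 ≤ Tsum := Finset.sum_nonneg fun _ _ => sq_nonneg _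
  set B := ((1 + √6 * c) * criticalRadius ev) ^ 2 with hB
  -- Each output coordinate of the residual values is approximated separately; the solutions become
  -- the columns of `Γ'`.
  choose α hα using fun a : Fin d =>
    hS.exists_sum_ev_mul_sq_le hc hU hev fun i => p (x i) a
  set Γ' : Matrix (Fin s) (Fin d) ℝ := Matrix.of fun j a => α a j with hΓ'
  set W : Fin n → EuclideanSpace ℝ (Fin d) :=
    fun i => p (x i) - WithLp.toLp 2 ((Sᵀ * Γ') i) with hW
  have hTin : Tsum = inner ℝ p (kerComb H x W) := by
    have e1 : kerComb H x W = (∑ i, kerFun H (x i) (p (x i))) - sketchedFun H x S Γ' := by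
      rw [kerComb_def, sketchedFun, ← Finset.sum_sub_distrib]
      exact Finset.sum_congr rfl fun i _ => by rw [hW, map_sub]
    have e2 : inner ℝ p (sketchedFun H x S Γ') = 0 := horth Γ'
    rw [e1, inner_sub_right, e2, sub_zero, inner_sum, hT]
    exact Finset.sum_congr rfl fun i _ => by
      rw [inner_kerFun, real_inner_self_eq_norm_sq]
  have hWnorm : ‖kerComb H x W‖ ^ 2 ≤ n * (opNorm M * (B * Tsum)) := by
    rw [kerComb_def, hH.norm_sq_sum_kerFun]
    -- The coefficients in the eigenbasis of the Gram matrix: the squared norm becomes `n ∑ ev l ⟨R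
    -- l, M R l⟩`, and `M` separates from the scalar kernel as a factor `opNorm M`.
    set R : Fin n → EuclideanSpace ℝ (Fin d) := fun l => ∑ i, U i l • W i with hR
    have hk : ∀ i j, k (x i) (x j) = n * ∑ l, ev l * U i l * U j l := fun i j => by
      rw [← hU.apply_eq i j]
      simp only [gram, Matrix.smul_apply, Matrix.of_apply, smul_eq_mul]
      field_simp
    have e3 : ∑ i, ∑ j, k (x i) (x j) * inner ℝ (W i) (Matrix.toEuclideanCLM (𝕜 := ℝ) M (W j))
        = n * ∑ l, ev l * inner ℝ (R l) (Matrix.toEuclideanCLM (𝕜 := ℝ) M (R l)) := by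
      simp_rw [hk, hR, map_sum, sum_inner, inner_sum, map_smul, inner_smul_left, inner_smul_right,
        Finset.mul_sum, Finset.sum_mul]
      rw [Finset.sum_comm_cycle]
      refine Finset.sum_congr rfl fun l _ => Finset.sum_congr rfl fun i _ =>
        Finset.sum_congr rfl fun j _ => ?_
      simp only [conj_trivial]
      ring
    rw [e3]
    refine mul_le_mul_of_nonneg_left ?_ hn'.le
    have e4 : ∀ l, ev l * inner ℝ (R l) (Matrix.toEuclideanCLM (𝕜 := ℝ) M (R l))
        ≤ opNorm M * (ev l * ‖R l‖ ^ 2) := fun l => by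
      have h1 := real_inner_le_norm (R l) (Matrix.toEuclideanCLM (𝕜 := ℝ) M (R l))
      have h2 := (Matrix.toEuclideanCLM (𝕜 := ℝ) M).le_opNorm (R l)
      rw [norm_toEuclideanCLM_eq_opNorm] at h2
      have h3 : inner ℝ (R l) (Matrix.toEuclideanCLM (𝕜 := ℝ) M (R l))
          ≤ opNorm M * ‖R l‖ ^ 2 := by nlinarith [norm_nonneg (R l)]
      calc _ ≤ ev l * (opNorm M * ‖R l‖ ^ 2) := mul_le_mul_of_nonneg_left h3 (hev l)
        _ = _ := by ring
    refine (Finset.sum_le_sum fun l _ => e4 l).trans ?_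
    rw [← Finset.mul_sum]
    refine mul_le_mul_of_nonneg_left ?_ (opNorm_nonneg M)
    have e5 : ∀ l a, R l a = (Uᵀ *ᵥ ((fun i => p (x i) a) - Sᵀ *ᵥ α a)) l := fun l a => by
      rw [hR, hW]
      simp [Matrix.mulVec, dotProduct, Matrix.mul_apply, hΓ']
    simp_rw [EuclideanSpace.norm_sq_eq, Real.norm_eq_abs, sq_abs, e5, Finset.mul_sum]
    rw [Finset.sum_comm]
    refine (Finset.sum_le_sum fun a _ => hα a).trans (le_of_eq ?_)
    rw [← Finset.mul_sum, Finset.sum_comm, hT, hB]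
    simp_rw [EuclideanSpace.norm_sq_eq, Real.norm_eq_abs, sq_abs]
  have hTle : Tsum ≤ ‖kerComb H x W‖ := by
    rw [hTin]
    refine (real_inner_le_norm _ _).trans ?_
    exact mul_le_of_le_one_left (norm_nonneg _) (hp.trans hf)
  have hTsq : Tsum ^ 2 ≤ n * (opNorm M * (B * Tsum)) :=
    (pow_le_pow_left₀ hT0 hTle 2).trans hWnorm
  have hBe : (n : ℝ) * ((1 + √6 * c) ^ 2 * (opNorm M * criticalRadius ev ^ 2))
      = n * (opNorm M * B) := by rw [hB]; ring
  rw [hBe]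
  rcases hT0.eq_or_lt with h | h
  · rw [← h]
    have := opNorm_nonneg M
    positivity
  · nlinarith

end Sketch

end RKHS

end SketchedKernel

/-! ### Suprema over the unit ball: measurability and Rademacher complexity. -/

namespace SketchedKernel

open RKHS
open scoped BigOperators

lemma expect_le_sqrt_expect_sq {α : Type*} [Fintype α] [Nonempty α] (a : α → ℝ) :
    𝔼 i, a i ≤ √(𝔼 i, a i ^ 2) := by
  refine Real.le_sqrt_of_sq_le ?_
  set m := 𝔼 i, a i with hm
  have h : 0 ≤ 𝔼 i, (a i - m) ^ 2 := Finset.expect_nonneg fun i _ => sq_nonneg _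
  have e : 𝔼 i, (a i - m) ^ 2 = 𝔼 i, a i ^ 2 - m ^ 2 := by
    have : ∀ i, (a i - m) ^ 2 = a i ^ 2 - 2 * m * a i + m ^ 2 := fun i => by ring
    simp_rw [this]
    rw [Finset.expect_add_distrib, Finset.expect_sub_distrib, ← Finset.mul_expect,
      Fintype.expect_const, ← hm]
    ring
  linarith

section LossOn

variable {X : Type*} {d : ℕ} {H : Type*} [NormedAddCommGroup H]
  [InnerProductSpace ℝ H] [RKHS ℝ H X (EuclideanSpace ℝ (Fin d))]

/-- The loss of `f` at a data point, truncated to `0` outside the set `A` of data points. -/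
def lossOn (A : Set (X × EuclideanSpace ℝ (Fin d)))
    (ℓ : EuclideanSpace ℝ (Fin d) → EuclideanSpace ℝ (Fin d) → ℝ) (f : H)
    (p : X × EuclideanSpace ℝ (Fin d)) : ℝ :=
  A.indicator (fun p => ℓ (f p.1) p.2) p

/-- On the unit ball of `H` and on the data points in `A`, the loss takes values in `[0, 1]`
and is `L`-Lipschitz in the prediction. -/
structure IsRegularLoss (H : Type*) [NormedAddCommGroup H]
    [InnerProductSpace ℝ H] [RKHS ℝ H X (EuclideanSpace ℝ (Fin d))]
    (A : Set (X × EuclideanSpace ℝ (Fin d)))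
    (ℓ : EuclideanSpace ℝ (Fin d) → EuclideanSpace ℝ (Fin d) → ℝ) (L : ℝ) : Prop where
  nonneg : 0 ≤ L
  mem_Icc : ∀ f : H, ‖f‖ ≤ 1 → ∀ p ∈ A, ℓ (f p.1) p.2 ∈ Set.Icc (0 : ℝ) 1
  lipschitz : ∀ f g : H, ‖f‖ ≤ 1 → ‖g‖ ≤ 1 → ∀ p ∈ A,
    |ℓ (f p.1) p.2 - ℓ (g p.1) p.2| ≤ L * ‖f p.1 - g p.1‖

variable {A : Set (X × EuclideanSpace ℝ (Fin d))}
  {ℓ : EuclideanSpace ℝ (Fin d) → EuclideanSpace ℝ (Fin d) → ℝ} {L : ℝ}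

lemma IsRegularLoss.lossOn_mem_Icc (h : IsRegularLoss H A ℓ L) {f : H} (hf : ‖f‖ ≤ 1)
    (p : X × EuclideanSpace ℝ (Fin d)) : lossOn A ℓ f p ∈ Set.Icc (0 : ℝ) 1 := by
  by_cases hp : p ∈ A
  · rw [lossOn, Set.indicator_of_mem hp]; exact h.mem_Icc f hf p hp
  · rw [lossOn, Set.indicator_of_notMem hp]; simp

lemma IsRegularLoss.abs_lossOn_le (h : IsRegularLoss H A ℓ L) {f : H} (hf : ‖f‖ ≤ 1)
    (p : X × EuclideanSpace ℝ (Fin d)) : |lossOn A ℓ f p| ≤ 1 := by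
  have := h.lossOn_mem_Icc hf p
  rw [abs_of_nonneg this.1]; exact this.2

lemma IsRegularLoss.lossOn_lipschitz (h : IsRegularLoss H A ℓ L) {f g : H} (hf : ‖f‖ ≤ 1)
    (hg : ‖g‖ ≤ 1) (p : X × EuclideanSpace ℝ (Fin d)) :
    |lossOn A ℓ f p - lossOn A ℓ g p| ≤ L * ‖f p.1 - g p.1‖ := by
  by_cases hp : p ∈ A
  · simp only [lossOn, Set.indicator_of_mem hp]; exact h.lipschitz f g hf hg p hp
  · simp only [lossOn, Set.indicator_of_notMem hp, sub_self, abs_zero]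
    exact mul_nonneg h.nonneg (norm_nonneg _)

/-- The supremum over the unit ball of a linear combination of losses. -/
def supLoss (H : Type*) [NormedAddCommGroup H]
    [InnerProductSpace ℝ H] [RKHS ℝ H X (EuclideanSpace ℝ (Fin d))]
    (A : Set (X × EuclideanSpace ℝ (Fin d)))
    (ℓ : EuclideanSpace ℝ (Fin d) → EuclideanSpace ℝ (Fin d) → ℝ) {ι : Type*} [Fintype ι]
    (a : ι → ℝ) (w : ι → X × EuclideanSpace ℝ (Fin d)) : ℝ :=
  ⨆ f : {f : H // ‖f‖ ≤ 1}, ∑ i, a i * lossOn A ℓ f.1 (w i)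

instance : Nonempty {f : H // ‖f‖ ≤ 1} := ⟨⟨0, by simp⟩⟩

section Sup

variable {ι : Type*} [Fintype ι]

lemma IsRegularLoss.abs_sum_le (h : IsRegularLoss H A ℓ L) (a : ι → ℝ)
    (w : ι → X × EuclideanSpace ℝ (Fin d)) {f : H} (hf : ‖f‖ ≤ 1) :
    |∑ i, a i * lossOn A ℓ f (w i)| ≤ ∑ i, |a i| := by
  refine (Finset.abs_sum_le_sum_abs _ _).trans (Finset.sum_le_sum fun i _ => ?_)
  rw [abs_mul]
  exact mul_le_of_le_one_right (abs_nonneg _) (h.abs_lossOn_le hf _)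

lemma IsRegularLoss.bddAbove (h : IsRegularLoss H A ℓ L) (a : ι → ℝ)
    (w : ι → X × EuclideanSpace ℝ (Fin d)) :
    BddAbove (Set.range fun f : {f : H // ‖f‖ ≤ 1} => ∑ i, a i * lossOn A ℓ f.1 (w i)) :=
  ⟨∑ i, |a i|, by
    rintro _ ⟨f, rfl⟩; exact (le_abs_self _).trans (h.abs_sum_le a w f.2)⟩

lemma IsRegularLoss.le_supLoss (h : IsRegularLoss H A ℓ L) (a : ι → ℝ)
    (w : ι → X × EuclideanSpace ℝ (Fin d)) {f : H} (hf : ‖f‖ ≤ 1) :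
    ∑ i, a i * lossOn A ℓ f (w i) ≤ supLoss H A ℓ a w :=
  le_ciSup (h.bddAbove a w) ⟨f, hf⟩

lemma IsRegularLoss.abs_supLoss_le (h : IsRegularLoss H A ℓ L) (a : ι → ℝ)
    (w : ι → X × EuclideanSpace ℝ (Fin d)) : |supLoss H A ℓ a w| ≤ ∑ i, |a i| := by
  refine abs_le.2 ⟨?_, ciSup_le fun f => (abs_le.1 (h.abs_sum_le a w f.2)).2⟩
  exact (abs_le.1 (h.abs_sum_le a w (f := (0 : H)) (by simp))).1.trans
    (h.le_supLoss a w (by simp))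

variable [CompleteSpace H] {k : X → X → ℝ} {M : Matrix (Fin d) (Fin d) ℝ}

/-- In the unit ball, a sum of losses is nearly attained by a combination of kernel
functions with coefficients in a given dense sequence. -/
lemma IsRegularLoss.exists_dense_lt (h : IsRegularLoss H A ℓ L) (a : ι → ℝ)
    (w : ι → X × EuclideanSpace ℝ (Fin d)) {f : H} (hf : ‖f‖ ≤ 1)
    {c : ℕ → ι → EuclideanSpace ℝ (Fin d)} (hc : DenseRange c) {ε : ℝ} (hε : 0 < ε) :
    ∃ m, ‖kerComb H (fun i => (w i).1) (c m)‖ < 1 ∧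
      ∑ i, a i * lossOn A ℓ f (w i) - ε
        ≤ ∑ i, a i * lossOn A ℓ (kerComb H (fun i => (w i).1) (c m)) (w i) := by
  obtain ⟨b, hb, hbe⟩ := exists_kerComb_eq (fun i => (w i).1) f
  set T := kerComb H (fun i => (w i).1) with hT
  have hTc : Continuous T := by
    simp only [hT, kerComb, LinearMap.coe_mk, AddHom.coe_mk]; fun_prop
  set dist : (ι → EuclideanSpace ℝ (Fin d)) → ℝ :=
    fun b' => ∑ i, |a i| * (L * ‖f (w i).1 - T b' (w i).1‖) with hdist
  have hdc : Continuous dist := by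
    refine continuous_finsetSum _ fun i _ => ?_
    have := (RKHS.continuous_eval (H := H) (w i).1).comp hTc
    exact continuous_const.mul (continuous_const.mul (continuous_const.sub this).norm)
  have hopen : IsOpen {b' | ‖T b'‖ < 1 ∧ dist b' < ε} :=
    (isOpen_lt hTc.norm continuous_const).inter (isOpen_lt hdc continuous_const)
  -- The interpolant `b` agrees with `f` at the sample but may have norm exactly `1`; shrinking it
  -- by `t < 1` enters the open set that the dense sequence must meet.
  have hne : {b' | ‖T b'‖ < 1 ∧ dist b' < ε}.Nonempty := by
    have hd1 : dist ((1 : ℝ) • b) = 0 := by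
      simp only [hdist, one_smul]
      refine Finset.sum_eq_zero fun i _ => ?_
      rw [hbe i]; simp
    have hcont : Continuous fun t : ℝ => dist (t • b) := by fun_prop
    have hev : ∀ᶠ t : ℝ in nhdsWithin 1 (Set.Iio 1), dist (t • b) < ε :=
      (hcont.continuousAt.eventually_lt continuousAt_const (by rw [hd1]; exact hε)).filter_mono
        nhdsWithin_le_nhds
    have hev2 : ∀ᶠ t : ℝ in nhdsWithin 1 (Set.Iio 1), t ∈ Set.Ioo 0 1 :=
      Ioo_mem_nhdsLT (by norm_num)
    obtain ⟨t, ht, ht0, ht1⟩ := (hev.and hev2).exists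
    refine ⟨t • b, ?_, ht⟩
    rw [map_smul, norm_smul, Real.norm_of_nonneg ht0.le]
    nlinarith [norm_nonneg (T b), hb.trans hf]
  obtain ⟨_, ⟨h1, h2⟩, m, rfl⟩ := hc.inter_open_nonempty _ hopen hne
  refine ⟨m, h1, ?_⟩
  have : ∑ i, a i * lossOn A ℓ f (w i) - ∑ i, a i * lossOn A ℓ (T (c m)) (w i)
      ≤ dist (c m) := by
    rw [← Finset.sum_sub_distrib]
    refine Finset.sum_le_sum fun i _ => ?_
    rw [← mul_sub]
    refine (le_abs_self _).trans ?_
    rw [abs_mul]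
    exact mul_le_mul_of_nonneg_left (h.lossOn_lipschitz hf h1.le _) (abs_nonneg _)
  linarith

/-- Only finitely many values of `f` matter, so even for nonseparable `H` the supremum reduces to
kernel combinations at the sample points, with coefficients in a countable dense set. Their norms
and values depend measurably on the sample through `k`. -/
lemma IsRegularLoss.measurable_supLoss [MeasurableSpace X] (h : IsRegularLoss H A ℓ L)
    (hA : MeasurableSet A)
    (hℓ : Measurable fun p : EuclideanSpace ℝ (Fin d) × EuclideanSpace ℝ (Fin d) => ℓ p.1 p.2)
    (hH : HasDecomposableKernel H k M) (hk : Measurable fun p : X × X => k p.1 p.2)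
    (a : ι → ℝ) : Measurable fun w => supLoss H A ℓ a w := by
  classical
  set c := TopologicalSpace.denseSeq (ι → EuclideanSpace ℝ (Fin d)) with hc
  set T : (ι → X × EuclideanSpace ℝ (Fin d)) → ℕ → H :=
    fun w m => kerComb H (fun i => (w i).1) (c m) with hT
  -- The default `-∑ |a i|` is a lower bound for `supLoss`, so combinations outside the ball do not
  -- affect the supremum.
  set F : ℕ → (ι → X × EuclideanSpace ℝ (Fin d)) → ℝ := fun m w =>
    if ‖T w m‖ ^ 2 < 1 then ∑ i, a i * lossOn A ℓ (T w m) (w i) else -∑ i, |a i| with hF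
  have hlt : ∀ w m, ‖T w m‖ ^ 2 < 1 ↔ ‖T w m‖ < 1 := fun w m => by
    rw [sq_lt_one_iff₀ (norm_nonneg _)]
  have hFle : ∀ m w, F m w ≤ supLoss H A ℓ a w := by
    intro m w
    simp only [hF]
    split_ifs with hm
    · exact h.le_supLoss a w ((hlt w m).1 hm).le
    · exact (abs_le.1 (h.abs_supLoss_le a w)).1
  have hbdd : ∀ w, BddAbove (Set.range fun m => F m w) := fun w =>
    ⟨supLoss H A ℓ a w, by rintro _ ⟨m, rfl⟩; exact hFle m w⟩
  have heq : (fun w => supLoss H A ℓ a w) = fun w => ⨆ m, F m w := by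
    funext w
    refine le_antisymm (ciSup_le fun f => ?_) (ciSup_le fun m => hFle m w)
    refine le_of_forall_pos_le_add fun ε hε => ?_
    obtain ⟨m, hm, hle⟩ := h.exists_dense_lt a w f.2 (TopologicalSpace.denseRange_denseSeq _) hε
    have h1 : F m w = ∑ i, a i * lossOn A ℓ (T w m) (w i) := by
      simp only [hF]
      rw [if_pos ((hlt w m).2 hm)]
    have h2 := le_ciSup (hbdd w) m
    simp only [h1] at h2
    have h3 : ∑ i, a i * lossOn A ℓ f.1 (w i) - ε ≤ ∑ i, a i * lossOn A ℓ (T w m) (w i) := hle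
    linarith
  rw [heq]
  have hkij : ∀ i j : ι, Measurable fun w : ι → X × EuclideanSpace ℝ (Fin d) =>
      k (w i).1 (w j).1 := fun i j =>
    hk.comp ((measurable_fst.comp (measurable_pi_apply i)).prodMk
      (measurable_fst.comp (measurable_pi_apply j)))
  refine Measurable.iSup fun m => ?_
  refine Measurable.ite ?_ ?_ measurable_const
  · refine measurableSet_lt ?_ measurable_const
    simp only [hT, kerComb_def, hH.norm_sq_sum_kerFun]
    exact Finset.measurable_sum _ fun i _ => Finset.measurable_sum _ fun j _ =>
      (hkij i j).mul_const _
  · refine Finset.measurable_sum _ fun i _ => Measurable.const_mul ?_ _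
    have e : ∀ w : ι → X × EuclideanSpace ℝ (Fin d), lossOn A ℓ (T w m) (w i)
        = ((fun w : ι → X × EuclideanSpace ℝ (Fin d) => w i) ⁻¹' A).indicator (fun w => ℓ
          (∑ j, k (w i).1 (w j).1 • Matrix.toEuclideanCLM (𝕜 := ℝ) M (c m j)) (w i).2) w := by
      intro w
      simp only [lossOn, hT, Set.indicator, hH.kerComb_apply, Set.mem_preimage]
    simp_rw [e]
    refine Measurable.indicator ?_ (hA.preimage (measurable_pi_apply i))
    refine hℓ.comp (Measurable.prodMk ?_ (measurable_snd.comp (measurable_pi_apply i)))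
    exact Finset.measurable_sum _ fun j _ => (hkij i j).smul_const _

end Sup

section Rademacher

variable [CompleteSpace H] {k : X → X → ℝ} {M : Matrix (Fin d) (Fin d) ℝ} {n : ℕ} {κ : ℝ}

lemma HasDecomposableKernel.trace_nonneg (hH : HasDecomposableKernel H k M) : 0 ≤ M.trace :=
  hH.posSemidef.trace_nonneg

/-- The empirical Rademacher complexity of the losses of the unit ball. -/
lemma IsRegularLoss.expect_supLoss_le (h : IsRegularLoss H A ℓ L)
    (hH : HasDecomposableKernel H k M) (hκ : ∀ x x' : X, k x x' ≤ κ)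
    (z : Fin n → X × EuclideanSpace ℝ (Fin d)) :
    𝔼 σ : Fin n → Bool, supLoss H A ℓ (fun i => signOf (σ i)) z
      ≤ 2 * L * √(n * (κ * M.trace)) := by
  have hcon := expect_iSup_signs_le_vector (T := {f : H // ‖f‖ ≤ 1}) (d := d) (fun _ => 0)
    (fun i f => lossOn A ℓ f.1 (z i)) (fun i f a => L * f.1 (z i).1 a)
    ⟨0, by rintro _ ⟨f, rfl⟩; exact le_rfl⟩
    (fun i => ⟨1, fun f => h.abs_lossOn_le f.2 _⟩)
    (fun i => ⟨L * √(k (z i).1 (z i).1 * opNorm M), fun f a => by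
      rw [abs_mul, abs_of_nonneg h.nonneg]
      refine mul_le_mul_of_nonneg_left ?_ h.nonneg
      refine ((PiLp.norm_apply_le (f.1 (z i).1) a).trans (hH.norm_apply_le f.1 _)).trans ?_
      exact mul_le_of_le_one_left (Real.sqrt_nonneg _) f.2⟩)
    (fun i f g => by
      refine (h.lossOn_lipschitz f.2 g.2 _).trans (le_of_eq ?_)
      have e : ∑ a, (L * f.1 (z i).1 a - L * g.1 (z i).1 a) ^ 2
          = L ^ 2 * ‖f.1 (z i).1 - g.1 (z i).1‖ ^ 2 := by
        rw [EuclideanSpace.norm_sq_eq, Finset.mul_sum]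
        refine Finset.sum_congr rfl fun a _ => ?_
        rw [Real.norm_eq_abs, sq_abs, PiLp.sub_apply]; ring
      rw [e, ← mul_pow, Real.sqrt_sq (mul_nonneg h.nonneg (norm_nonneg _))])
  simp only [zero_add] at hcon
  refine hcon.trans ?_
  -- The contracted sum is `L ⟨f, V ε⟩`, so its supremum over the ball is at most `L ‖V ε‖`. Jensen
  -- and the orthogonality of the signs bound `𝔼 ‖V ε‖` by `√(n κ Tr M)`.
  set V : (Fin n → Fin d → Bool) → H := fun ε =>
    0 + ∑ i, ∑ a, signOf (ε i a) • kerFun H (z i).1 (EuclideanSpace.single a (1 : ℝ)) with hV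
  have h1 : ∀ ε : Fin n → Fin d → Bool,
      (⨆ f : {f : H // ‖f‖ ≤ 1}, 2 * ∑ i, ∑ a, signOf (ε i a) * (L * f.1 (z i).1 a))
        ≤ 2 * L * ‖V ε‖ := by
    intro ε
    refine ciSup_le fun f => ?_
    have e : ∑ i, ∑ a, signOf (ε i a) * (L * f.1 (z i).1 a) = L * inner ℝ f.1 (V ε) := by
      rw [hV]
      simp only [zero_add, inner_sum, inner_smul_right, inner_kerFun, Finset.mul_sum]
      refine Finset.sum_congr rfl fun i _ => Finset.sum_congr rfl fun a _ => ?_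
      simp [EuclideanSpace.inner_single_right]
      ring
    rw [e, ← mul_assoc]
    refine mul_le_mul_of_nonneg_left ((real_inner_le_norm _ _).trans ?_)
      (mul_nonneg (by norm_num) h.nonneg)
    exact mul_le_of_le_one_left (norm_nonneg _) f.2
  refine (Finset.expect_le_expect fun ε _ => h1 ε).trans ?_
  rw [← Finset.mul_expect]
  refine mul_le_mul_of_nonneg_left ?_ (mul_nonneg (by norm_num) h.nonneg)
  refine (expect_le_sqrt_expect_sq _).trans (Real.sqrt_le_sqrt ?_)
  rw [expect_norm_sq_add_signs₂]
  simp only [norm_zero, ne_eq, OfNat.ofNat_ne_zero, not_false_eq_true, zero_pow, zero_add,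
    hH.sum_norm_kerFun_basis_sq]
  refine (Finset.sum_le_sum fun i _ =>
    mul_le_mul_of_nonneg_right (hκ _ _) hH.trace_nonneg).trans (le_of_eq ?_)
  simp

end Rademacher

end LossOn

end SketchedKernel

/-! ### Symmetrization and the uniform deviation inequality. -/

namespace SketchedKernel

open RKHS
open scoped BigOperators

section General

variable {Z : Type*} [MeasurableSpace Z] (P : Measure Z) [IsProbabilityMeasure P] {n : ℕ}

/-- Symmetrization: the integral of a function of two independent samples is bounded by a pointwise
bound of its average over the exchanges of corresponding points of the samples. -/
lemma integral_integral_le_of_expect_swap (J : (Fin n → Z) → (Fin n → Z) → ℝ)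
    (hJ : Measurable fun p : (Fin n → Z) × (Fin n → Z) => J p.1 p.2) {B : ℝ}
    (hB : ∀ z z', |J z z'| ≤ B) {C : ℝ}
    (hC : ∀ z z' : Fin n → Z, 𝔼 σ : Fin n → Bool,
      J (fun i => if σ i then z i else z' i) (fun i => if σ i then z' i else z i) ≤ C) :
    ∫ z, ∫ z', J z z' ∂(Measure.pi fun _ => P) ∂(Measure.pi fun _ => P) ≤ C := by
  rw [← integral_prod (μ := Measure.pi fun _ : Fin n => P) (ν := Measure.pi fun _ : Fin n => P)
    (fun p : (Fin n → Z) × (Fin n → Z) => J p.1 p.2)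
    (integrable_of_abs_le hJ fun p => hB p.1 p.2)]
  rw [← (measurePreserving_arrowProdEquivProdArrow Z Z (Fin n) (fun _ => P)
    (fun _ => P)).integral_comp']
  set Q : Measure (Fin n → Z × Z) := Measure.pi fun _ => P.prod P with hQ
  set F : (Fin n → Z × Z) → ℝ := fun p => J (fun i => (p i).1) (fun i => (p i).2) with hF
  change ∫ p, F p ∂Q ≤ _
  have hFm : Measurable F := hJ.comp
    ((measurable_pi_lambda _ fun i => measurable_fst.comp (measurable_pi_apply i)).prodMk
      (measurable_pi_lambda _ fun i => measurable_snd.comp (measurable_pi_apply i)))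
  -- Pairing the two samples pointwise makes the law a power of `P.prod P`, invariant under each
  -- coordinatewise swap; the integral thus equals that of its average over swaps.
  set sw : (Fin n → Bool) → (Fin n → Z × Z) → Fin n → Z × Z :=
    fun σ p i => (if σ i then id else Prod.swap) (p i) with hsw
  have hswm : ∀ σ, MeasurePreserving (sw σ) Q Q := fun σ =>
    measurePreserving_pi _ _ fun i => by
      cases σ i
      · simpa using Measure.measurePreserving_swap
      · simpa using MeasurePreserving.id _
  have hinv : ∀ σ, ∫ p, F (sw σ p) ∂Q = ∫ p, F p ∂Q := fun σ =>
    (integral_map (hswm σ).measurable.aemeasurable hFm.aestronglyMeasurable).symm.trans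
      (by rw [(hswm σ).map_eq])
  have hpoint : ∀ p, 𝔼 σ, F (sw σ p) ≤ C := by
    intro p
    refine le_trans (le_of_eq ?_) (hC (fun i => (p i).1) fun i => (p i).2)
    refine Finset.expect_congr rfl fun σ _ => ?_
    simp only [hF, hsw]
    congr 1 <;> funext i <;> cases σ i <;> rfl
  have hint : ∀ σ, Integrable (fun p => F (sw σ p)) Q := fun σ =>
    integrable_of_abs_le (hFm.comp (hswm σ).measurable) fun p => hB _ _
  have havg : ∫ p, F p ∂Q = ∫ p, 𝔼 σ, F (sw σ p) ∂Q := by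
    simp_rw [Fintype.expect_eq_sum_div_card]
    rw [integral_div, integral_finsetSum _ fun σ _ => hint σ]
    simp_rw [hinv]
    rw [Finset.sum_const, nsmul_eq_mul, Finset.card_univ, mul_div_cancel_left₀]
    exact Nat.cast_ne_zero.2 Fintype.card_ne_zero
  rw [havg]
  have hE : Integrable (fun p => 𝔼 σ, F (sw σ p)) Q := by
    simp_rw [Fintype.expect_eq_sum_div_card]
    exact (integrable_finsetSum _ fun σ _ => hint σ).div_const _
  refine (integral_mono hE (integrable_const _) hpoint).trans (le_of_eq ?_)
  simp

/-- With probability at least `1 - δ`, a function of the sample with bounded differences `8 / n`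
exceeds its mean by at most `2 √(8 log (4 / δ) / n)`. -/
lemma exists_good_set_of_bounded_differences (hn : 0 < n) (Φ : (Fin n → Z) → ℝ)
    (hΦ : Measurable Φ) {B : ℝ} (hB : ∀ z, |Φ z| ≤ B)
    (hu : ∀ z i w, Φ z - Φ (Function.update z i w) ≤ 8 / n) {δ : ℝ} (hδ : 0 < δ) (hδ1 : δ < 1) :
    ∃ G : Set (Fin n → Z), MeasurableSet G ∧
      ENNReal.ofReal (1 - δ) ≤ (Measure.pi fun _ => P) G ∧
      ∀ z ∈ G, Φ z ≤ ∫ z, Φ z ∂(Measure.pi fun _ => P) + 2 * √(8 * Real.log (4 / δ) / n) := by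
  have hn' : (0 : ℝ) < n := Nat.cast_pos.2 hn
  have hlog : 0 < Real.log (4 / δ) := Real.log_pos (by rw [lt_div_iff₀ hδ]; linarith)
  set ε : ℝ := 2 * √(8 * Real.log (4 / δ) / n) with hε
  have hε0 : 0 ≤ ε := by positivity
  have hε2 : ε ^ 2 = 32 * Real.log (4 / δ) / n := by
    rw [hε, mul_pow, Real.sq_sqrt (by positivity)]; ring
  have hmc := measureReal_ge_le_of_bounded_differences P Φ hΦ hB hu hε0
  -- Differences `8 / n` give variance proxy `16 / n`, so this `ε` makes the failure probability at
  -- most `δ / 4`.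
  have hexp : -ε ^ 2 / (2 * (n * (8 / (n : ℝ) / 2) ^ 2)) = -Real.log (4 / δ) := by
    rw [hε2]; field_simp; norm_num
  rw [hexp, Real.exp_neg, Real.exp_log (by positivity), inv_div] at hmc
  set m := ∫ z, Φ z ∂(Measure.pi fun _ => P) with hm
  have hbad : MeasurableSet {z | ε ≤ Φ z - m} :=
    measurableSet_le measurable_const (hΦ.sub_const _)
  refine ⟨{z | ε ≤ Φ z - m}ᶜ, hbad.compl, ?_, fun z hz => ?_⟩
  · rw [← ofReal_measureReal, measureReal_compl hbad]
    refine ENNReal.ofReal_le_ofReal ?_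
    rw [probReal_univ]
    linarith
  · have hz' : Φ z - m < ε := not_le.1 hz
    linarith

end General

section Deviation

variable {X : Type*} {d : ℕ} {H : Type*} [NormedAddCommGroup H]
  [InnerProductSpace ℝ H] [RKHS ℝ H X (EuclideanSpace ℝ (Fin d))]
  {A : Set (X × EuclideanSpace ℝ (Fin d))}
  {ℓ : EuclideanSpace ℝ (Fin d) → EuclideanSpace ℝ (Fin d) → ℝ} {L : ℝ}
  {k : X → X → ℝ} {M : Matrix (Fin d) (Fin d) ℝ} {n : ℕ} {κ : ℝ}

/-- The largest gap, over the unit ball, between the empirical risks of two samples. -/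
def ghostGap (H : Type*) [NormedAddCommGroup H]
    [InnerProductSpace ℝ H] [RKHS ℝ H X (EuclideanSpace ℝ (Fin d))]
    (A : Set (X × EuclideanSpace ℝ (Fin d)))
    (ℓ : EuclideanSpace ℝ (Fin d) → EuclideanSpace ℝ (Fin d) → ℝ)
    (z z' : Fin n → X × EuclideanSpace ℝ (Fin d)) : ℝ :=
  supLoss H A ℓ (Sum.elim (fun _ : Fin n => -(1 / (n : ℝ))) (fun _ : Fin n => 1 / (n : ℝ)))
    (Sum.elim z z')

lemma sum_ghost_eq (f : H) (z z' : Fin n → X × EuclideanSpace ℝ (Fin d)) :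
    ∑ i, Sum.elim (fun _ : Fin n => -(1 / (n : ℝ))) (fun _ : Fin n => 1 / (n : ℝ)) i
        * lossOn A ℓ f (Sum.elim z z' i)
      = (1 / (n : ℝ)) * ∑ i, (lossOn A ℓ f (z' i) - lossOn A ℓ f (z i)) := by
  rw [Fintype.sum_sum_type, Finset.sum_sub_distrib, mul_sub, Finset.mul_sum, Finset.mul_sum]
  simp
  ring

lemma IsRegularLoss.le_ghostGap (h : IsRegularLoss H A ℓ L)
    (z z' : Fin n → X × EuclideanSpace ℝ (Fin d)) {f : H} (hf : ‖f‖ ≤ 1) :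
    (1 / (n : ℝ)) * ∑ i, (lossOn A ℓ f (z' i) - lossOn A ℓ f (z i)) ≤ ghostGap H A ℓ z z' := by
  rw [← sum_ghost_eq]
  exact h.le_supLoss _ _ hf

lemma ghostGap_le {z z' : Fin n → X × EuclideanSpace ℝ (Fin d)} {B : ℝ}
    (hB : ∀ f : H, ‖f‖ ≤ 1 →
      (1 / (n : ℝ)) * ∑ i, (lossOn A ℓ f (z' i) - lossOn A ℓ f (z i)) ≤ B) :
    ghostGap H A ℓ z z' ≤ B :=
  ciSup_le fun f => by rw [sum_ghost_eq]; exact hB f.1 f.2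

lemma IsRegularLoss.abs_ghostGap_le (h : IsRegularLoss H A ℓ L)
    (z z' : Fin n → X × EuclideanSpace ℝ (Fin d)) : |ghostGap H A ℓ z z'| ≤ 2 := by
  refine (h.abs_supLoss_le _ _).trans ?_
  rw [Fintype.sum_sum_type]
  simp only [Sum.elim_inl, Sum.elim_inr, abs_neg, Finset.sum_const, Finset.card_univ,
    Fintype.card_fin, nsmul_eq_mul]
  rw [abs_of_nonneg (by positivity)]
  rcases Nat.eq_zero_or_pos n with rfl | hn
  · simp
  · have : (n : ℝ) ≠ 0 := by positivity
    field_simp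
    norm_num

lemma IsRegularLoss.ghostGap_sub_update_le (h : IsRegularLoss H A ℓ L)
    (z z' : Fin n → X × EuclideanSpace ℝ (Fin d)) (i : Fin n)
    (w : X × EuclideanSpace ℝ (Fin d)) :
    ghostGap H A ℓ z z' - ghostGap H A ℓ (Function.update z i w) z' ≤ 1 / n := by
  rw [sub_le_iff_le_add]
  refine ghostGap_le fun f hf => ?_
  have h1 := h.le_ghostGap (Function.update z i w) z' hf
  have h2 : ∑ j, (lossOn A ℓ f (z' j) - lossOn A ℓ f (z j))
      = ∑ j, (lossOn A ℓ f (z' j) - lossOn A ℓ f (Function.update z i w j))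
        + (lossOn A ℓ f w - lossOn A ℓ f (z i)) := by
    rw [← sub_eq_iff_eq_add', ← Finset.sum_sub_distrib, Finset.sum_eq_single i]
    · simp
    · intro j _ hj; simp [Function.update_of_ne hj]
    · simp
  rw [h2, mul_add]
  have h3 : lossOn A ℓ f w - lossOn A ℓ f (z i) ≤ 1 := by
    linarith [(h.lossOn_mem_Icc hf w).2, (h.lossOn_mem_Icc hf (z i)).1]
  have h4 := mul_le_mul_of_nonneg_left h3 (by positivity : (0 : ℝ) ≤ 1 / n)
  linarith

variable [MeasurableSpace X] [CompleteSpace H]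

lemma IsRegularLoss.measurable_ghostGap (h : IsRegularLoss H A ℓ L) (hA : MeasurableSet A)
    (hℓ : Measurable fun p : EuclideanSpace ℝ (Fin d) × EuclideanSpace ℝ (Fin d) => ℓ p.1 p.2)
    (hH : HasDecomposableKernel H k M) (hk : Measurable fun p : X × X => k p.1 p.2) :
    Measurable fun p : (Fin n → X × EuclideanSpace ℝ (Fin d))
      × (Fin n → X × EuclideanSpace ℝ (Fin d)) => ghostGap H A ℓ p.1 p.2 := by
  refine (h.measurable_supLoss hA hℓ hH hk _).comp (measurable_pi_lambda _ fun i => ?_)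
  cases i with
  | inl i => exact (measurable_pi_apply i).comp measurable_fst
  | inr i => exact (measurable_pi_apply i).comp measurable_snd

lemma measurable_lossOn (hA : MeasurableSet A)
    (hℓ : Measurable fun p : EuclideanSpace ℝ (Fin d) × EuclideanSpace ℝ (Fin d) => ℓ p.1 p.2)
    (hH : HasDecomposableKernel H k M) (hk : Measurable fun p : X × X => k p.1 p.2) (f : H) :
    Measurable (lossOn A ℓ f) :=
  Measurable.indicator (hℓ.comp (((hH.measurable_coe hk f).comp measurable_fst).prodMk
    measurable_snd)) hA

variable (P : Measure (X × EuclideanSpace ℝ (Fin d))) [IsProbabilityMeasure P]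

/-- The expected largest gap between the empirical risks of two independent samples. -/
lemma IsRegularLoss.integral_ghostGap_le (h : IsRegularLoss H A ℓ L) (hn : 0 < n)
    (hA : MeasurableSet A)
    (hℓ : Measurable fun p : EuclideanSpace ℝ (Fin d) × EuclideanSpace ℝ (Fin d) => ℓ p.1 p.2)
    (hH : HasDecomposableKernel H k M) (hk : Measurable fun p : X × X => k p.1 p.2)
    (hκ : ∀ x x' : X, k x x' ≤ κ) :
    ∫ z, ∫ z', ghostGap H A ℓ z z' ∂(Measure.pi fun _ : Fin n => P)
        ∂(Measure.pi fun _ : Fin n => P) ≤ 4 * L * √(κ * M.trace / n) := by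
  have hn' : (0 : ℝ) < n := Nat.cast_pos.2 hn
  refine integral_integral_le_of_expect_swap P _ (h.measurable_ghostGap hA hℓ hH hk)
    h.abs_ghostGap_le fun z z' => ?_
  have h1 : ∀ σ : Fin n → Bool, ghostGap H A ℓ (fun i => if σ i then z i else z' i)
      (fun i => if σ i then z' i else z i) ≤ (1 / (n : ℝ)) *
        (supLoss H A ℓ (fun i => signOf (σ i)) z'
          + supLoss H A ℓ (fun i => signOf (!σ i)) z) := by
    intro σ
    refine ghostGap_le fun f hf => ?_
    refine mul_le_mul_of_nonneg_left ?_ (by positivity)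
    refine le_trans (le_of_eq ?_) (add_le_add (h.le_supLoss _ _ hf) (h.le_supLoss _ _ hf))
    rw [← Finset.sum_add_distrib]
    refine Finset.sum_congr rfl fun i _ => ?_
    cases σ i <;> simp <;> ring
  refine (Finset.expect_le_expect fun σ _ => h1 σ).trans ?_
  rw [← Finset.mul_expect, Finset.expect_add_distrib, expect_neg_signs
    (fun σ => supLoss H A ℓ (fun i => signOf (σ i)) z)]
  -- Each of the two samples contributes `2 L √(n κ Tr M)`; after division by `n` they make the
  -- factor `4`.
  have h2 := h.expect_supLoss_le hH hκ z'
  have h3 := h.expect_supLoss_le hH hκ z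
  have h4 : √(n * (κ * M.trace)) = n * √(κ * M.trace / n) := by
    have : (n : ℝ) * (κ * M.trace) = n ^ 2 * (κ * M.trace / n) := by field_simp
    rw [this, Real.sqrt_mul (by positivity), Real.sqrt_sq hn'.le]
  rw [h4] at h2 h3
  rw [div_mul_eq_mul_div, one_mul, div_le_iff₀ hn']
  linarith

lemma IsRegularLoss.integrable_ghostGap (h : IsRegularLoss H A ℓ L) (hA : MeasurableSet A)
    (hℓ : Measurable fun p : EuclideanSpace ℝ (Fin d) × EuclideanSpace ℝ (Fin d) => ℓ p.1 p.2)
    (hH : HasDecomposableKernel H k M) (hk : Measurable fun p : X × X => k p.1 p.2)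
    (z : Fin n → X × EuclideanSpace ℝ (Fin d)) :
    Integrable (fun z' => ghostGap H A ℓ z z') (Measure.pi fun _ : Fin n => P) := by
  have hm := h.measurable_ghostGap (n := n) hA hℓ hH hk
  have hz : Measurable fun z' : Fin n → X × EuclideanSpace ℝ (Fin d) => (z, z') :=
    measurable_prodMk_left
  have hmz := hm.comp hz
  simp only [Function.comp_def] at hmz
  exact integrable_of_abs_le hmz (h.abs_ghostGap_le z)

/-- The true risk is the mean empirical risk of a ghost sample. Integrating `ghostGap` over that
sample gives a measurable majorant, uniform in `f`, so the supremum of the true gaps itself need not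
be shown measurable. -/
lemma IsRegularLoss.integral_sub_le_integral_ghostGap (h : IsRegularLoss H A ℓ L) (hn : 0 < n)
    (hA : MeasurableSet A)
    (hℓ : Measurable fun p : EuclideanSpace ℝ (Fin d) × EuclideanSpace ℝ (Fin d) => ℓ p.1 p.2)
    (hH : HasDecomposableKernel H k M) (hk : Measurable fun p : X × X => k p.1 p.2)
    (z : Fin n → X × EuclideanSpace ℝ (Fin d)) {f : H} (hf : ‖f‖ ≤ 1) :
    ∫ p, lossOn A ℓ f p ∂P - (1 / (n : ℝ)) * ∑ i, lossOn A ℓ f (z i)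
      ≤ ∫ z', ghostGap H A ℓ z z' ∂(Measure.pi fun _ : Fin n => P) := by
  have hn' : (0 : ℝ) < n := Nat.cast_pos.2 hn
  set μ : Measure (Fin n → X × EuclideanSpace ℝ (Fin d)) := Measure.pi fun _ => P with hμ
  have hlm := measurable_lossOn hA hℓ hH hk f
  have hli : ∀ i : Fin n, Integrable (fun z' : Fin n → X × EuclideanSpace ℝ (Fin d) =>
      lossOn A ℓ f (z' i)) μ := fun i =>
    integrable_of_abs_le (hlm.comp (measurable_pi_apply i)) fun z' => h.abs_lossOn_le hf _
  have hev : ∀ i : Fin n, ∫ z', lossOn A ℓ f (z' i) ∂μ = ∫ p, lossOn A ℓ f p ∂P := fun i => by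
    have hpe := measurePreserving_eval (fun _ : Fin n => P) i
    have := integral_map (μ := μ) hpe.measurable.aemeasurable
      (f := lossOn A ℓ f) hlm.aestronglyMeasurable
    rw [hpe.map_eq] at this
    exact this.symm
  have hi : ∀ i ∈ (Finset.univ : Finset (Fin n)), Integrable
      (fun z' : Fin n → X × EuclideanSpace ℝ (Fin d) =>
        lossOn A ℓ f (z' i) - lossOn A ℓ f (z i)) μ :=
    fun i _ => (hli i).sub (integrable_const _)
  have hi2 : Integrable (fun z' : Fin n → X × EuclideanSpace ℝ (Fin d) =>
      (1 / (n : ℝ)) * ∑ i, (lossOn A ℓ f (z' i) - lossOn A ℓ f (z i))) μ :=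
    (integrable_finsetSum _ hi).const_mul _
  have h1 := integral_mono hi2 (h.integrable_ghostGap P hA hℓ hH hk z)
    fun z' => h.le_ghostGap z z' hf
  refine le_trans (le_of_eq ?_) h1
  rw [integral_const_mul, integral_finsetSum _ hi]
  have h2 : ∀ i : Fin n, ∫ z', (lossOn A ℓ f (z' i) - lossOn A ℓ f (z i)) ∂μ
      = ∫ p, lossOn A ℓ f p ∂P - lossOn A ℓ f (z i) := fun i => by
    rw [integral_sub (hli i) (integrable_const _), hev, integral_const, probReal_univ, one_smul]
  rw [Finset.sum_congr rfl fun i _ => h2 i, Finset.sum_sub_distrib, Finset.sum_const,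
    Finset.card_univ, Fintype.card_fin, nsmul_eq_mul, mul_sub, ← mul_assoc, one_div,
    inv_mul_cancel₀ hn'.ne', one_mul]

/-- Uniform deviation inequality over the unit ball, with an additional statistic `Ψ`. -/
theorem IsRegularLoss.exists_good_samples (h : IsRegularLoss H A ℓ L) (hn : 0 < n)
    (hA : MeasurableSet A)
    (hℓ : Measurable fun p : EuclideanSpace ℝ (Fin d) × EuclideanSpace ℝ (Fin d) => ℓ p.1 p.2)
    (hH : HasDecomposableKernel H k M) (hk : Measurable fun p : X × X => k p.1 p.2)
    (hκ : ∀ x x' : X, k x x' ≤ κ) (Ψ : (Fin n → X × EuclideanSpace ℝ (Fin d)) → ℝ)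
    (hΨ : Measurable Ψ) {B : ℝ} (hB : ∀ z, |Ψ z| ≤ B)
    (hΨ_update : ∀ z i w, Ψ z - Ψ (Function.update z i w) ≤ 7 / n)
    {δ : ℝ} (hδ : 0 < δ) (hδ1 : δ < 1) :
    ∃ G : Set (Fin n → X × EuclideanSpace ℝ (Fin d)), MeasurableSet G ∧
      ENNReal.ofReal (1 - δ) ≤ (Measure.pi fun _ => P) G ∧
      ∀ z ∈ G, ∀ f : H, ‖f‖ ≤ 1 →
        ∫ p, lossOn A ℓ f p ∂P + Ψ z ≤ (1 / (n : ℝ)) * ∑ i, lossOn A ℓ f (z i)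
          + ∫ z, Ψ z ∂(Measure.pi fun _ => P)
          + 4 * L * √(κ * M.trace / n) + 2 * √(8 * Real.log (4 / δ) / n) := by
  set μ : Measure (Fin n → X × EuclideanSpace ℝ (Fin d)) := Measure.pi fun _ => P with hμ
  set D : (Fin n → X × EuclideanSpace ℝ (Fin d)) → ℝ :=
    fun z => ∫ z', ghostGap H A ℓ z z' ∂μ with hD
  have hDm : Measurable D := ((h.measurable_ghostGap hA hℓ hH
    hk).stronglyMeasurable.integral_prod_right (ν := μ)).measurable
  have hDB : ∀ z, |D z| ≤ 2 := fun z => abs_integral_le_of_abs_le fun z' => h.abs_ghostGap_le z z'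
  have hDu : ∀ z i w, D z - D (Function.update z i w) ≤ 1 / n := by
    intro z i w
    have h1 := h.integrable_ghostGap P hA hℓ hH hk z
    have h2 := h.integrable_ghostGap P hA hℓ hH hk (Function.update z i w)
    simp only [hD]
    rw [← integral_sub h1 h2]
    refine (integral_mono (h1.sub h2) (integrable_const (1 / (n : ℝ)))
      fun z' => h.ghostGap_sub_update_le z z' i w).trans (le_of_eq ?_)
    simp
  have hDint : ∫ z, D z ∂μ ≤ 4 * L * √(κ * M.trace / n) :=
    h.integral_ghostGap_le P hn hA hℓ hH hk hκ
  -- `D` and `Ψ` are controlled together, on one event with one deviation term: the differences `1 /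
  -- n` and `7 / n` add up to `8 / n`.
  obtain ⟨G, hG, hGp, hGz⟩ := exists_good_set_of_bounded_differences P hn (fun z => D z + Ψ z)
    (hDm.add hΨ) (fun z => (abs_add_le _ _).trans (add_le_add (hDB z) (hB z)))
    (fun z i w => by
      have h1 := hDu z i w
      have h2 := hΨ_update z i w
      have h3 : (8 : ℝ) / n = 1 / n + 7 / n := by ring
      linarith) hδ hδ1
  refine ⟨G, hG, hGp, fun z hz f hf => ?_⟩
  have h1 := hGz z hz
  rw [integral_add (integrable_of_abs_le hDm hDB) (integrable_of_abs_le hΨ hB)] at h1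
  have h2 : _ ≤ D z := h.integral_sub_le_integral_ghostGap P hn hA hℓ hH hk z hf
  linarith

end Deviation

end SketchedKernel

/-! ### Sample events, moments of the product law and the competitor. -/

namespace SketchedKernel

open RKHS

/-- Events determined by an i.i.d. sample, up to null sets. -/
lemma withProbAtLeast_of_sample {Ω Z : Type*} [MeasurableSpace Ω] [MeasurableSpace Z] {n : ℕ}
    (Pr : Measure Ω) [IsProbabilityMeasure Pr] (P : Measure Z) (ζ : Fin n → Ω → Z)
    (h_law : ∀ i, HasLaw (ζ i) P Pr) (h_indep : iIndepFun ζ Pr) {p : ℝ} {G : Set (Fin n → Z)}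
    (hG : MeasurableSet G) (hp : ENNReal.ofReal p ≤ (Measure.pi fun _ => P) G) {S : Set Ω}
    (h : ∀ᵐ ω ∂Pr, (fun i => ζ i ω) ∈ G → ω ∈ S) : WithProbAtLeast Pr p S := by
  have hae : ∀ i, AEMeasurable (ζ i) Pr := fun i => (h_law i).aemeasurable
  have hmap : Pr.map (fun ω i => ζ i ω) = Measure.pi fun _ => P := by
    rw [(iIndepFun_iff_map_fun_eq_pi_map hae).1 h_indep]
    simp_rw [fun i => (h_law i).map_eq]
  have hF : AEMeasurable (fun ω i => ζ i ω) Pr := aemeasurable_pi_lambda _ hae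
  have hall : ∀ᵐ ω ∂Pr, hF.mk _ ω ∈ G → ω ∈ S := by
    filter_upwards [h, hF.ae_eq_mk] with ω h1 h2 h3
    exact h1 (by rw [h2]; exact h3)
  -- The sample is only a.e. measurable, so the event is built from a measurable modification, minus
  -- a measurable null set that holds all exceptions.
  set N := toMeasurable Pr {ω | ¬(hF.mk _ ω ∈ G → ω ∈ S)} with hN
  have hN0 : Pr N = 0 := by rw [hN, measure_toMeasurable]; exact hall
  refine ⟨(hF.mk _ ⁻¹' G) \ N, (hF.measurable_mk hG).diff (measurableSet_toMeasurable _ _), ?_, ?_⟩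
  · rintro ω ⟨h1, h2⟩
    by_contra h3
    exact h2 (subset_toMeasurable _ _ fun h4 => h3 (h4 h1))
  · rw [measure_sdiff_null hN0, ← Measure.map_apply hF.measurable_mk hG,
      ← Measure.map_congr hF.ae_eq_mk, hmap]
    exact hp

section Mean

variable {Z : Type*} [MeasurableSpace Z] {P : Measure Z} [IsProbabilityMeasure P] {n : ℕ}

lemma integral_eval_pi {F : Z → ℝ} (hF : Measurable F) (i : Fin n) :
    ∫ z, F (z i) ∂(Measure.pi fun _ : Fin n => P) = ∫ p, F p ∂P := by
  have hpe := measurePreserving_eval (fun _ : Fin n => P) i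
  have := integral_map (μ := Measure.pi fun _ : Fin n => P) hpe.measurable.aemeasurable
    (f := F) hF.aestronglyMeasurable
  rw [hpe.map_eq] at this
  exact this.symm

lemma integral_mean_pi (hn : 0 < n) {F : Z → ℝ} (hF : Measurable F) {B : ℝ}
    (hB : ∀ p, |F p| ≤ B) :
    ∫ z, (1 / (n : ℝ)) * ∑ i, F (z i) ∂(Measure.pi fun _ : Fin n => P) = ∫ p, F p ∂P := by
  have hn' : (0 : ℝ) < n := Nat.cast_pos.2 hn
  have hi : ∀ i ∈ (Finset.univ : Finset (Fin n)), Integrable (fun z : Fin n → Z => F (z i))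
      (Measure.pi fun _ : Fin n => P) := fun i _ =>
    integrable_of_abs_le (hF.comp (measurable_pi_apply i)) fun z => hB _
  rw [integral_const_mul, integral_finsetSum _ hi]
  simp_rw [integral_eval_pi hF]
  rw [Finset.sum_const, Finset.card_univ, Fintype.card_fin, nsmul_eq_mul, ← mul_assoc, one_div,
    inv_mul_cancel₀ hn'.ne', one_mul]

omit [MeasurableSpace Z] in
lemma mean_sub_update (F : Z → ℝ) (z : Fin n → Z) (i : Fin n) (w : Z) :
    (1 / (n : ℝ)) * ∑ j, F (z j) - (1 / (n : ℝ)) * ∑ j, F (Function.update z i w j)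
      = (1 / (n : ℝ)) * (F (z i) - F w) := by
  rw [← mul_sub, ← Finset.sum_sub_distrib, Finset.sum_eq_single i]
  · simp
  · intro j _ hj; simp [Function.update_of_ne hj]
  · simp

omit [MeasurableSpace Z] in
lemma abs_mean_le {F : Z → ℝ} {B : ℝ} (hB0 : 0 ≤ B) (hB : ∀ p, |F p| ≤ B) (z : Fin n → Z) :
    |(1 / (n : ℝ)) * ∑ i, F (z i)| ≤ B := by
  rw [abs_mul, abs_of_nonneg (by positivity), div_mul_eq_mul_div, one_mul]
  refine div_le_of_le_mul₀ (by positivity) hB0 ?_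
  refine (Finset.abs_sum_le_sum_abs _ _).trans ((Finset.sum_le_sum fun i _ => hB (z i)).trans ?_)
  simp [mul_comm]

/-- The first variable is integrated innermost because the first-order condition makes that integral
vanish in `IsBoundedSquareLoss.integral_gradNorm_le`. -/
lemma integral_pair_pi {F : Z → Z → ℝ} (hF : Measurable fun p : Z × Z => F p.1 p.2) {B : ℝ}
    (hB : ∀ p q, |F p q| ≤ B) {i j : Fin n} (hij : i ≠ j) :
    ∫ z, F (z i) (z j) ∂(Measure.pi fun _ : Fin n => P) = ∫ q, ∫ p, F p q ∂P ∂P := by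
  have hind : IndepFun (fun z : Fin n → Z => z i) (fun z => z j)
      (Measure.pi fun _ : Fin n => P) :=
    (iIndepFun_pi (μ := fun _ : Fin n => P) (X := fun _ => id)
      fun _ => measurable_id.aemeasurable).indepFun hij
  have hmap := (indepFun_iff_map_prod_eq_prod_map_map (measurable_pi_apply i).aemeasurable
    (measurable_pi_apply j).aemeasurable).1 hind
  have h1 := measurePreserving_eval (fun _ : Fin n => P) i
  have h2 := measurePreserving_eval (fun _ : Fin n => P) j
  have e1 : (Measure.pi fun _ : Fin n => P).map (fun z : Fin n → Z => z i) = P := h1.map_eq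
  have e2 : (Measure.pi fun _ : Fin n => P).map (fun z : Fin n → Z => z j) = P := h2.map_eq
  rw [e1, e2] at hmap
  have hm : Measurable fun z : Fin n → Z => (z i, z j) :=
    (measurable_pi_apply i).prodMk (measurable_pi_apply j)
  have h3 := integral_map (μ := Measure.pi fun _ : Fin n => P) hm.aemeasurable
    (f := fun p : Z × Z => F p.1 p.2) hF.aestronglyMeasurable
  rw [hmap] at h3
  have h4 := integral_prod_symm (μ := P) (ν := P) (fun p : Z × Z => F p.1 p.2)
    (integrable_of_abs_le hF fun p => hB p.1 p.2)
  exact h3.symm.trans h4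

lemma integral_le_sqrt_integral_sq {μ : Measure Z} [IsProbabilityMeasure μ] {F : Z → ℝ}
    (hF : Measurable F) {B : ℝ} (hB : ∀ z, |F z| ≤ B) :
    ∫ z, F z ∂μ ≤ √(∫ z, F z ^ 2 ∂μ) := by
  refine Real.le_sqrt_of_sq_le ?_
  set m := ∫ z, F z ∂μ with hm
  have hi : Integrable F μ := integrable_of_abs_le hF hB
  have hi2 : Integrable (fun z => F z ^ 2) μ :=
    integrable_of_abs_le (B := B ^ 2) (hF.pow_const 2) fun z => by
      rw [abs_pow]; exact pow_le_pow_left₀ (abs_nonneg _) (hB z) 2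
  have h0 : 0 ≤ ∫ z, (F z - m) ^ 2 ∂μ := integral_nonneg fun z => sq_nonneg _
  have e : ∀ z, (F z - m) ^ 2 = F z ^ 2 - 2 * m * F z + m ^ 2 := fun z => by ring
  simp_rw [e] at h0
  have hi3 : Integrable (fun z => F z ^ 2 - 2 * m * F z) μ := hi2.sub (hi.const_mul _)
  rw [integral_add hi3 (integrable_const _),
    integral_sub hi2 (hi.const_mul _), integral_const_mul, ← hm] at h0
  simp only [integral_const, probReal_univ, one_smul] at h0
  linarith

end Mean

section Empirical

variable {X : Type*} {d : ℕ} {H : Type*} [NormedAddCommGroup H]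
  [InnerProductSpace ℝ H] [RKHS ℝ H X (EuclideanSpace ℝ (Fin d))] [CompleteSpace H]
  {k : X → X → ℝ} {M : Matrix (Fin d) (Fin d) ℝ} {n s : ℕ}
  {ℓ : EuclideanSpace ℝ (Fin d) → EuclideanSpace ℝ (Fin d) → ℝ}

/-- The sketched estimator has nearly the empirical risk of some `g` in the unit ball that is close
to a given `f` in the seminorm of the sample. -/
lemma IsSketchedSolution.exists_competitor (hH : HasDecomposableKernel H k M) (hn : 0 < n)
    {c : ℝ} (hc : 0 < c) {x : Fin n → X} {y : Fin n → EuclideanSpace ℝ (Fin d)}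
    {U : Matrix (Fin n) (Fin n) ℝ} {ev : Fin n → ℝ}
    (hU : IsEigendecomposition ((n : ℝ)⁻¹ • gram k x) U ev)
    {S : Matrix (Fin s) (Fin n) ℝ} (hS : IsSatisfiable c U ev S) {lam : ℝ} (hlam : 0 < lam)
    {Γ : Matrix (Fin s) (Fin d) ℝ} (hΓ : IsSketchedSolution H ℓ lam k M x y S Γ)
    (f : H) (hf : ‖f‖ ≤ 1) :
    ∃ g : H, ‖g‖ ≤ 1 ∧
      (1 / (n : ℝ)) * ∑ i, ‖g (x i) - f (x i)‖ ^ 2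
        ≤ (1 + √6 * c) ^ 2 * (opNorm M * criticalRadius ev ^ 2) ∧
      (1 / (n : ℝ)) * ∑ i, ℓ (sketchedFun H x S Γ (x i)) (y i)
        ≤ (1 / (n : ℝ)) * ∑ i, ℓ (g (x i)) (y i) + lam / 2 := by
  have hn' : (0 : ℝ) < n := Nat.cast_pos.2 hn
  obtain ⟨Γ', h1, h2⟩ := hH.exists_sketchedFun_approx hn hc x hU hS f hf
  refine ⟨sketchedFun H x S Γ', h1, ?_, ?_⟩
  · rw [div_mul_eq_mul_div, one_mul, div_le_iff₀ hn']
    linarith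
  -- The trace penalty is the squared norm in `H`: at most `lam / 2` for the competitor, and
  -- nonnegative, hence dropped, for the estimator.
  · have h3 := hΓ.le Γ' h1
    rw [hH.sketchedObjective_eq, hH.sketchedObjective_eq] at h3
    have h4 : lam / 2 * ‖sketchedFun H x S Γ'‖ ^ 2 ≤ lam / 2 * 1 :=
      mul_le_mul_of_nonneg_left (pow_le_one₀ (norm_nonneg _) h1) (by positivity)
    have h5 : 0 ≤ lam / 2 * ‖sketchedFun H x S Γ‖ ^ 2 := by positivity
    linarith

end Empirical

section Risk

variable {X : Type*} [MeasurableSpace X] {d : ℕ} {H : Type*} [NormedAddCommGroup H]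
  [InnerProductSpace ℝ H] [RKHS ℝ H X (EuclideanSpace ℝ (Fin d))]
  {A : Set (X × EuclideanSpace ℝ (Fin d))}
  {ℓ : EuclideanSpace ℝ (Fin d) → EuclideanSpace ℝ (Fin d) → ℝ}
  {P : Measure (X × EuclideanSpace ℝ (Fin d))}

lemma integral_lossOn (hAP : ∀ᵐ p ∂P, p ∈ A) (f : H) :
    ∫ p, lossOn A ℓ f p ∂P = risk P ℓ f :=
  integral_congr_ae (by
    filter_upwards [hAP] with p hp
    rw [lossOn, Set.indicator_of_mem hp])

lemma mean_le_sqrt_mean_sq {n : ℕ} (a : Fin n → ℝ) :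
    (1 / (n : ℝ)) * ∑ i, a i ≤ √((1 / (n : ℝ)) * ∑ i, a i ^ 2) := by
  refine Real.le_sqrt_of_sq_le ?_
  rcases Nat.eq_zero_or_pos n with rfl | hn
  · simp
  have hn' : (0 : ℝ) < n := Nat.cast_pos.2 hn
  have h := sq_sum_le_card_mul_sum_sq (s := Finset.univ) (f := a)
  rw [Finset.card_univ, Fintype.card_fin] at h
  rw [mul_pow]
  calc (1 / (n : ℝ)) ^ 2 * (∑ i, a i) ^ 2 ≤ (1 / (n : ℝ)) ^ 2 * (n * ∑ i, a i ^ 2) :=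
        mul_le_mul_of_nonneg_left h (by positivity)
    _ = _ := by field_simp

end Risk

end SketchedKernel

/-! ### The square loss: expansion, gradient and first-order condition. -/

namespace SketchedKernel

open RKHS

lemma measurable_eval_pair {ι Z : Type*} [MeasurableSpace Z] (i j : ι) :
    Measurable fun z : ι → Z => (z i, z j) :=
  (measurable_pi_apply i).prodMk (measurable_pi_apply j)

section SquareLoss

variable {X : Type*} {d : ℕ} {H : Type*} [NormedAddCommGroup H]
  [InnerProductSpace ℝ H] [RKHS ℝ H X (EuclideanSpace ℝ (Fin d))]
  {A : Set (X × EuclideanSpace ℝ (Fin d))}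
  {ℓ : EuclideanSpace ℝ (Fin d) → EuclideanSpace ℝ (Fin d) → ℝ}
  {k : X → X → ℝ} {M : Matrix (Fin d) (Fin d) ℝ} {n : ℕ} {κ : ℝ}

/-- On the data points in `A`, the square loss of the unit ball is at most `1`, and the outputs are
in the unit ball. -/
structure IsBoundedSquareLoss (H : Type*) [NormedAddCommGroup H]
    [InnerProductSpace ℝ H] [RKHS ℝ H X (EuclideanSpace ℝ (Fin d))]
    (A : Set (X × EuclideanSpace ℝ (Fin d)))
    (ℓ : EuclideanSpace ℝ (Fin d) → EuclideanSpace ℝ (Fin d) → ℝ) : Prop where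
  eq : ∀ z y : EuclideanSpace ℝ (Fin d), ℓ z y = ‖z - y‖ ^ 2 / 2
  le_one : ∀ f : H, ‖f‖ ≤ 1 → ∀ p ∈ A, ℓ (f p.1) p.2 ≤ 1
  norm_le_one : ∀ p ∈ A, ‖p.2‖ ≤ 1

/-- The ball is symmetric, so the loss bound holds for `f` and `-f`; the parallelogram law adds the
two. -/
lemma IsBoundedSquareLoss.norm_sq_add_le (h : IsBoundedSquareLoss H A ℓ) {f : H} (hf : ‖f‖ ≤ 1)
    {p : X × EuclideanSpace ℝ (Fin d)} (hp : p ∈ A) : ‖f p.1‖ ^ 2 + ‖p.2‖ ^ 2 ≤ 2 := by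
  have h1 := h.le_one f hf p hp
  have h2 := h.le_one (-f) (by rwa [norm_neg]) p hp
  rw [h.eq] at h1 h2
  rw [RKHS.coe_neg, Pi.neg_apply, ← norm_neg, neg_sub, sub_neg_eq_add, add_comm] at h2
  have := parallelogram_law_with_norm ℝ (f p.1) p.2
  nlinarith

/-- The residual of `f` at a data point, truncated to `0` outside `A`. -/
def residual (A : Set (X × EuclideanSpace ℝ (Fin d))) (f : H)
    (p : X × EuclideanSpace ℝ (Fin d)) : EuclideanSpace ℝ (Fin d) :=
  A.indicator (fun p => f p.1 - p.2) p

/-- The part of the square loss that does not depend on the competitor of `f`. -/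
def offset (A : Set (X × EuclideanSpace ℝ (Fin d))) (f : H)
    (p : X × EuclideanSpace ℝ (Fin d)) : ℝ :=
  A.indicator (fun p => (‖p.2‖ ^ 2 - ‖f p.1‖ ^ 2) / 2) p

/-- With `v` the competitor, `u` the minimizer and `w` the output, the linear term carries all of
`v` rather than `v - u`: it is bounded by `gradNorm` since the competitor lies in the ball. -/
lemma square_expansion (u v w : EuclideanSpace ℝ (Fin d)) :
    ‖v - w‖ ^ 2 / 2
      = ‖v - u‖ ^ 2 / 2 + inner ℝ v (u - w) + (‖w‖ ^ 2 - ‖u‖ ^ 2) / 2 := by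
  rw [norm_sub_sq_real, norm_sub_sq_real, inner_sub_right]
  ring

lemma IsBoundedSquareLoss.lossOn_eq (h : IsBoundedSquareLoss H A ℓ) (f g : H)
    {p : X × EuclideanSpace ℝ (Fin d)} (hp : p ∈ A) :
    ℓ (g p.1) p.2 = ‖g p.1 - f p.1‖ ^ 2 / 2 + inner ℝ (g p.1) (residual A f p)
      + offset A f p := by
  rw [h.eq, residual, offset, Set.indicator_of_mem hp, Set.indicator_of_mem hp]
  exact square_expansion _ _ _

lemma IsBoundedSquareLoss.norm_residual_sq_le (h : IsBoundedSquareLoss H A ℓ) {f : H}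
    (hf : ‖f‖ ≤ 1) (p : X × EuclideanSpace ℝ (Fin d)) : ‖residual A f p‖ ^ 2 ≤ 2 := by
  by_cases hp : p ∈ A
  · rw [residual, Set.indicator_of_mem hp]
    have := h.le_one f hf p hp
    rw [h.eq] at this
    linarith
  · rw [residual, Set.indicator_of_notMem hp]; simp

lemma IsBoundedSquareLoss.abs_offset_le (h : IsBoundedSquareLoss H A ℓ) {f : H}
    (hf : ‖f‖ ≤ 1) (p : X × EuclideanSpace ℝ (Fin d)) : |offset A f p| ≤ 1 := by
  by_cases hp : p ∈ A
  · rw [offset, Set.indicator_of_mem hp, abs_le]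
    have := h.norm_sq_add_le hf hp
    constructor <;> nlinarith [sq_nonneg ‖f p.1‖, sq_nonneg ‖p.2‖]
  · rw [offset, Set.indicator_of_notMem hp]; simp

variable [CompleteSpace H]

lemma HasDecomposableKernel.norm_apply_le_sqrt (hH : HasDecomposableKernel H k M)
    (hκ : ∀ x x' : X, k x x' ≤ κ) (f : H) (x : X) : ‖f x‖ ≤ ‖f‖ * √(κ * opNorm M) :=
  (hH.norm_apply_le f x).trans (mul_le_mul_of_nonneg_left (Real.sqrt_le_sqrt
    (mul_le_mul_of_nonneg_right (hκ x x) (opNorm_nonneg M))) (norm_nonneg _))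

lemma IsBoundedSquareLoss.isRegularLoss (h : IsBoundedSquareLoss H A ℓ)
    (hH : HasDecomposableKernel H k M) (hκ : ∀ x x' : X, k x x' ≤ κ) :
    IsRegularLoss H A ℓ (√(κ * opNorm M) + 1) where
  nonneg := by positivity
  mem_Icc f hf p hp := ⟨by rw [h.eq]; positivity, h.le_one f hf p hp⟩
  lipschitz f g hf hg p hp := by
    have e : ‖f p.1 - p.2‖ ^ 2 / 2 - ‖g p.1 - p.2‖ ^ 2 / 2
        = (‖f p.1 - p.2‖ - ‖g p.1 - p.2‖) * ((‖f p.1 - p.2‖ + ‖g p.1 - p.2‖) / 2) := by ring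
    rw [h.eq, h.eq, e, abs_mul, mul_comm]
    have hb : ∀ f : H, ‖f‖ ≤ 1 → ‖f p.1 - p.2‖ ≤ √(κ * opNorm M) + 1 := fun f hf => by
      refine (norm_sub_le _ _).trans (add_le_add ?_ (h.norm_le_one p hp))
      exact (hH.norm_apply_le_sqrt hκ f p.1).trans
        (mul_le_of_le_one_left (Real.sqrt_nonneg _) hf)
    refine mul_le_mul ?_ ?_ (abs_nonneg _) (by positivity)
    · rw [abs_of_nonneg (by positivity)]
      linarith [hb f hf, hb g hg]
    · refine (abs_norm_sub_norm_le _ _).trans (le_of_eq ?_)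
      rw [sub_sub_sub_cancel_right]

/-- A bound free of `κ` and `M`, as the deviation term demands. For `g = kerFun H p.1 r` the
normalized `g` lies in the ball, so `‖g p.1‖ ≤ √2 ‖g‖`; with `‖r‖ ≤ √2` this gives `‖g‖² = ⟨g p.1,
r⟩ ≤ 2 ‖g‖`. -/
lemma IsBoundedSquareLoss.norm_kerFun_residual_le (h : IsBoundedSquareLoss H A ℓ) {f : H}
    (hf : ‖f‖ ≤ 1) (p : X × EuclideanSpace ℝ (Fin d)) :
    ‖kerFun H p.1 (residual A f p)‖ ≤ 2 := by
  by_cases hp : p ∈ A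
  · set g := kerFun H p.1 (residual A f p) with hg
    rcases (norm_nonneg g).eq_or_lt with h0 | h0
    · rw [← h0]; norm_num
    have hgn : ‖(‖g‖⁻¹ • g : H)‖ ≤ 1 := by
      rw [norm_smul, norm_inv, norm_norm, inv_mul_cancel₀ h0.ne']
    have h1 := h.norm_sq_add_le hgn hp
    rw [RKHS.coe_smul, Pi.smul_apply, norm_smul, norm_inv, norm_norm] at h1
    have h2 : ‖g p.1‖ ^ 2 ≤ 2 * ‖g‖ ^ 2 := by
      have h3 : (‖g‖⁻¹ * ‖g p.1‖) ^ 2 ≤ 2 := by nlinarith [sq_nonneg ‖p.2‖]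
      rw [mul_pow, inv_pow, inv_mul_le_iff₀ (by positivity)] at h3
      linarith
    have h4 : ‖g‖ ^ 2 = inner ℝ (g p.1) (residual A f p) := by
      rw [← real_inner_self_eq_norm_sq]
      conv_lhs => rw [hg]
      rw [kerFun_inner, real_inner_comm]
    have h5 := real_inner_le_norm (g p.1) (residual A f p)
    have h6 := h.norm_residual_sq_le hf p
    have h7 : (‖g‖ ^ 2) ^ 2 ≤ (2 * ‖g‖) ^ 2 := by
      calc (‖g‖ ^ 2) ^ 2 ≤ (‖g p.1‖ * ‖residual A f p‖) ^ 2 := by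
            refine pow_le_pow_left₀ (sq_nonneg _) ?_ 2
            rw [h4]; exact h5
        _ = ‖g p.1‖ ^ 2 * ‖residual A f p‖ ^ 2 := by ring
        _ ≤ (2 * ‖g‖ ^ 2) * 2 := mul_le_mul h2 h6 (sq_nonneg _) (by positivity)
        _ = (2 * ‖g‖) ^ 2 := by ring
    have h8 := le_of_sq_le_sq h7 (by positivity)
    nlinarith
  · rw [residual, Set.indicator_of_notMem hp, map_zero, norm_zero]; norm_num

lemma HasDecomposableKernel.norm_kerFun_sq_le_trace (hH : HasDecomposableKernel H k M)
    (hκ : ∀ x x' : X, k x x' ≤ κ) (x : X) (u : EuclideanSpace ℝ (Fin d)) :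
    ‖kerFun H x u‖ ^ 2 ≤ κ * M.trace * ‖u‖ ^ 2 := by
  have e : u = ∑ a, u a • EuclideanSpace.single a (1 : ℝ) := by
    ext b
    simp [Pi.single_apply]
  have h1 : ‖kerFun H x u‖ ≤ ∑ a, |u a| * ‖kerFun H x (EuclideanSpace.single a (1 : ℝ))‖ := by
    conv_lhs => rw [e]
    rw [map_sum]
    refine (norm_sum_le _ _).trans (le_of_eq (Finset.sum_congr rfl fun a _ => ?_))
    rw [map_smul, norm_smul, Real.norm_eq_abs]
  have h2 := Finset.sum_mul_sq_le_sq_mul_sq Finset.univ (fun a => |u a|)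
    fun a => ‖kerFun H x (EuclideanSpace.single a (1 : ℝ))‖
  rw [hH.sum_norm_kerFun_basis_sq] at h2
  simp only [sq_abs] at h2
  have h3 : ∑ a, u a ^ 2 = ‖u‖ ^ 2 := by
    rw [EuclideanSpace.norm_sq_eq]; simp
  rw [h3] at h2
  refine (pow_le_pow_left₀ (norm_nonneg _) h1 2).trans (h2.trans ?_)
  rw [mul_comm]
  exact mul_le_mul_of_nonneg_right (mul_le_mul_of_nonneg_right (hκ _ _) hH.trace_nonneg)
    (sq_nonneg _)

/-- The norm of the gradient of the empirical risk at `f`. -/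
def gradNorm (A : Set (X × EuclideanSpace ℝ (Fin d))) (f : H)
    (z : Fin n → X × EuclideanSpace ℝ (Fin d)) : ℝ :=
  (1 / (n : ℝ)) * ‖∑ i, kerFun H (z i).1 (residual A f (z i))‖

lemma mean_inner_residual_le {f g : H} (hg : ‖g‖ ≤ 1)
    (z : Fin n → X × EuclideanSpace ℝ (Fin d)) :
    (1 / (n : ℝ)) * ∑ i, inner ℝ (g (z i).1) (residual A f (z i)) ≤ gradNorm A f z := by
  refine mul_le_mul_of_nonneg_left ?_ (by positivity)
  have e : ∑ i, inner ℝ (g (z i).1) (residual A f (z i))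
      = inner ℝ g (∑ i, kerFun H (z i).1 (residual A f (z i))) := by
    rw [inner_sum]
    exact Finset.sum_congr rfl fun i _ => by rw [inner_kerFun]
  rw [e]
  exact (real_inner_le_norm _ _).trans (mul_le_of_le_one_left (norm_nonneg _) hg)

lemma IsBoundedSquareLoss.abs_gradNorm_le (h : IsBoundedSquareLoss H A ℓ) {f : H}
    (hf : ‖f‖ ≤ 1) (z : Fin n → X × EuclideanSpace ℝ (Fin d)) : |gradNorm A f z| ≤ 2 := by
  rw [gradNorm, abs_of_nonneg (by positivity), div_mul_eq_mul_div, one_mul]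
  refine div_le_of_le_mul₀ (by positivity) (by norm_num) ?_
  refine (norm_sum_le _ _).trans ((Finset.sum_le_sum fun i _ =>
    h.norm_kerFun_residual_le hf (z i)).trans ?_)
  simp [mul_comm]

lemma IsBoundedSquareLoss.gradNorm_sub_update_le (h : IsBoundedSquareLoss H A ℓ) {f : H}
    (hf : ‖f‖ ≤ 1) (z : Fin n → X × EuclideanSpace ℝ (Fin d)) (i : Fin n)
    (w : X × EuclideanSpace ℝ (Fin d)) :
    gradNorm A f z - gradNorm A f (Function.update z i w) ≤ 4 / n := by
  have e : ∑ j, kerFun H (z j).1 (residual A f (z j))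
      - ∑ j, kerFun H (Function.update z i w j).1 (residual A f (Function.update z i w j))
      = kerFun H (z i).1 (residual A f (z i)) - kerFun H w.1 (residual A f w) := by
    rw [← Finset.sum_sub_distrib, Finset.sum_eq_single i]
    · simp
    · intro j _ hj; simp [Function.update_of_ne hj]
    · simp
  have h1 := norm_sub_norm_le (∑ j, kerFun H (z j).1 (residual A f (z j)))
    (∑ j, kerFun H (Function.update z i w j).1 (residual A f (Function.update z i w j)))
  rw [e] at h1
  have h2 := (norm_sub_le (kerFun H (z i).1 (residual A f (z i)))
    (kerFun H w.1 (residual A f w))).trans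
      (add_le_add (h.norm_kerFun_residual_le hf (z i)) (h.norm_kerFun_residual_le hf w))
  rw [gradNorm, gradNorm, ← mul_sub]
  calc _ ≤ (1 / (n : ℝ)) * (2 + 2) := mul_le_mul_of_nonneg_left (h1.trans h2) (by positivity)
    _ = 4 / n := by ring

lemma gradNorm_sq_eq (hH : HasDecomposableKernel H k M) (f : H)
    (z : Fin n → X × EuclideanSpace ℝ (Fin d)) :
    gradNorm A f z ^ 2 = (1 / (n : ℝ)) ^ 2 * ∑ i, ∑ j, k (z i).1 (z j).1
      * inner ℝ (residual A f (z i))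
        (Matrix.toEuclideanCLM (𝕜 := ℝ) M (residual A f (z j))) := by
  rw [gradNorm, mul_pow, hH.norm_sq_sum_kerFun]

variable [MeasurableSpace X]

lemma measurable_residual (hA : MeasurableSet A) (hH : HasDecomposableKernel H k M)
    (hk : Measurable fun p : X × X => k p.1 p.2) (f : H) : Measurable (residual A f) :=
  Measurable.indicator (((hH.measurable_coe hk f).comp measurable_fst).sub measurable_snd) hA

lemma measurable_offset (hA : MeasurableSet A) (hH : HasDecomposableKernel H k M)
    (hk : Measurable fun p : X × X => k p.1 p.2) (f : H) : Measurable (offset A f) :=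
  Measurable.indicator (((measurable_snd.norm.pow_const 2).sub
    (((hH.measurable_coe hk f).comp measurable_fst).norm.pow_const 2)).div_const 2) hA

lemma measurable_kernel_residual (hA : MeasurableSet A) (hH : HasDecomposableKernel H k M)
    (hk : Measurable fun p : X × X => k p.1 p.2) (f : H) :
    Measurable fun p : (X × EuclideanSpace ℝ (Fin d)) × (X × EuclideanSpace ℝ (Fin d)) =>
      k p.1.1 p.2.1 * inner ℝ (residual A f p.1)
        (Matrix.toEuclideanCLM (𝕜 := ℝ) M (residual A f p.2)) := by
  have hr := measurable_residual hA hH hk f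
  refine (hk.comp ((measurable_fst.comp measurable_fst).prodMk
    (measurable_fst.comp measurable_snd))).mul ?_
  exact (hr.comp measurable_fst).inner
    ((Matrix.toEuclideanCLM (𝕜 := ℝ) M).continuous.measurable.comp (hr.comp measurable_snd))

lemma measurable_gradNorm (hA : MeasurableSet A) (hH : HasDecomposableKernel H k M)
    (hk : Measurable fun p : X × X => k p.1 p.2) (f : H) :
    Measurable fun z : Fin n → X × EuclideanSpace ℝ (Fin d) => gradNorm A f z := by
  have e : ∀ z : Fin n → X × EuclideanSpace ℝ (Fin d), gradNorm A f z
      = √((1 / (n : ℝ)) ^ 2 * ∑ i, ∑ j, k (z i).1 (z j).1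
      * inner ℝ (residual A f (z i))
        (Matrix.toEuclideanCLM (𝕜 := ℝ) M (residual A f (z j)))) := fun z => by
    rw [← gradNorm_sq_eq hH, Real.sqrt_sq]
    exact mul_nonneg (by positivity) (norm_nonneg _)
  simp_rw [e]
  refine (Measurable.const_mul ?_ _).sqrt
  exact Finset.measurable_sum _ fun i _ => Finset.measurable_sum _ fun j _ =>
    (measurable_kernel_residual hA hH hk f).comp (measurable_eval_pair i j)

variable {P : Measure (X × EuclideanSpace ℝ (Fin d))} [IsProbabilityMeasure P]

lemma eq_zero_of_forall_le_quadratic {a b : ℝ} (h : ∀ t : ℝ, 0 ≤ t * a + t ^ 2 * b) : a = 0 := by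
  by_contra ha
  have hb : 0 < |b| + 1 := by positivity
  -- A step against the slope, short enough for the linear term to beat the quadratic one.
  have h1 := h (-a / (|b| + 1))
  have h2 : (-a / (|b| + 1)) * a + (-a / (|b| + 1)) ^ 2 * b
      = -(a ^ 2 / (|b| + 1) ^ 2) * (|b| + 1 - b) := by
    field_simp; ring
  rw [h2] at h1
  have h3 : 0 < a ^ 2 / (|b| + 1) ^ 2 := by positivity
  have h4 : 0 < |b| + 1 - b := by linarith [le_abs_self b]
  nlinarith

/-- At a minimizer of the risk, the residual is orthogonal to `H` in mean. -/
lemma IsBoundedSquareLoss.integral_inner_residual_eq_zero (h : IsBoundedSquareLoss H A ℓ)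
    (hA : MeasurableSet A) (hAP : ∀ᵐ p ∂P, p ∈ A) (hH : HasDecomposableKernel H k M)
    (hk : Measurable fun p : X × X => k p.1 p.2) (hκ : ∀ x x' : X, k x x' ≤ κ) {f : H}
    (hf : ‖f‖ ≤ 1) (hmin : ∀ g : H, risk P ℓ f ≤ risk P ℓ g) (g : H) :
    ∫ p, inner ℝ (g p.1) (residual A f p) ∂P = 0 := by
  have hgm : Measurable fun p : X × EuclideanSpace ℝ (Fin d) => g p.1 :=
    (hH.measurable_coe hk g).comp measurable_fst
  have hfm : Measurable fun p : X × EuclideanSpace ℝ (Fin d) => f p.1 :=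
    (hH.measurable_coe hk f).comp measurable_fst
  have hres := measurable_residual hA hH hk f
  set B := ‖g‖ * √(κ * opNorm M) with hB
  have hgB : ∀ x, ‖g x‖ ≤ B := fun x => hH.norm_apply_le_sqrt hκ g x
  have hB0 : 0 ≤ B := by positivity
  have hi0 : Integrable (fun p => ‖residual A f p‖ ^ 2 / 2) P :=
    integrable_of_abs_le (B := 1) ((hres.norm.pow_const 2).div_const 2) fun p => by
      rw [abs_of_nonneg (by positivity)]
      linarith [h.norm_residual_sq_le hf p]
  have hi1 : Integrable (fun p => inner ℝ (g p.1) (residual A f p)) P :=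
    integrable_of_abs_le (B := B * √2) (hgm.inner hres) fun p => by
      refine (abs_real_inner_le_norm _ _).trans (mul_le_mul (hgB _) ?_ (norm_nonneg _) hB0)
      exact Real.le_sqrt_of_sq_le (h.norm_residual_sq_le hf p)
  have hi2 : Integrable (fun p : X × EuclideanSpace ℝ (Fin d) => ‖g p.1‖ ^ 2 / 2) P :=
    integrable_of_abs_le (B := B ^ 2 / 2) ((hgm.norm.pow_const 2).div_const 2) fun p => by
      rw [abs_of_nonneg (by positivity)]
      have := pow_le_pow_left₀ (norm_nonneg _) (hgB p.1) 2
      linarith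
  -- Minimality over all of `H`, not just the ball, allows every `t` of either sign; hence an
  -- equality and not a variational inequality.
  have hrisk : ∀ t : ℝ, risk P ℓ (f + t • g) = ∫ p, ‖residual A f p‖ ^ 2 / 2 ∂P
      + (t * ∫ p, inner ℝ (g p.1) (residual A f p) ∂P + t ^ 2 * ∫ p, ‖g p.1‖ ^ 2 / 2 ∂P) := by
    intro t
    have hi12 : Integrable (fun p => t * inner ℝ (g p.1) (residual A f p)
        + t ^ 2 * (‖g p.1‖ ^ 2 / 2)) P := (hi1.const_mul t).add (hi2.const_mul (t ^ 2))
    rw [← integral_const_mul, ← integral_const_mul,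
      ← integral_add (hi1.const_mul t) (hi2.const_mul (t ^ 2)), ← integral_add hi0 hi12, risk]
    refine integral_congr_ae ?_
    filter_upwards [hAP] with p hp
    rw [h.eq, residual, Set.indicator_of_mem hp, RKHS.coe_add, RKHS.coe_smul, Pi.add_apply,
      Pi.smul_apply]
    have e : f p.1 + t • g p.1 - p.2 = (f p.1 - p.2) + t • g p.1 := by abel
    rw [e, norm_add_sq_real, inner_smul_right, real_inner_comm, norm_smul, mul_pow,
      Real.norm_eq_abs, sq_abs]
    ring
  refine eq_zero_of_forall_le_quadratic (b := ∫ p, ‖g p.1‖ ^ 2 / 2 ∂P) fun t => ?_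
  have h1 := hmin (f + t • g)
  have h0 := hrisk 0
  rw [zero_smul, add_zero] at h0
  rw [h0, hrisk t] at h1
  linarith

/-- In the expansion at `g = f` the squared distance is zero, and the linear term has mean zero by
the first-order condition. -/
lemma IsBoundedSquareLoss.integral_offset_eq (h : IsBoundedSquareLoss H A ℓ)
    (hA : MeasurableSet A) (hAP : ∀ᵐ p ∂P, p ∈ A) (hH : HasDecomposableKernel H k M)
    (hk : Measurable fun p : X × X => k p.1 p.2) (hκ : ∀ x x' : X, k x x' ≤ κ) {f : H}
    (hf : ‖f‖ ≤ 1) (hmin : ∀ g : H, risk P ℓ f ≤ risk P ℓ g) :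
    ∫ p, offset A f p ∂P = risk P ℓ f := by
  have h0 := h.integral_inner_residual_eq_zero hA hAP hH hk hκ hf hmin f
  have hfm : Measurable fun p : X × EuclideanSpace ℝ (Fin d) => f p.1 :=
    (hH.measurable_coe hk f).comp measurable_fst
  have hi1 : Integrable (fun p => inner ℝ (f p.1) (residual A f p)) P :=
    integrable_of_abs_le (B := ‖f‖ * √(κ * opNorm M) * √2)
      (hfm.inner (measurable_residual hA hH hk f)) fun p => by
      refine (abs_real_inner_le_norm _ _).trans (mul_le_mul (hH.norm_apply_le_sqrt hκ f p.1) ?_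
        (norm_nonneg _) (by positivity))
      exact Real.le_sqrt_of_sq_le (h.norm_residual_sq_le hf p)
  have hi2 : Integrable (offset A f) P :=
    integrable_of_abs_le (measurable_offset hA hH hk f) (h.abs_offset_le hf)
  rw [← zero_add (∫ p, offset A f p ∂P), ← h0, ← integral_add hi1 hi2, risk]
  refine integral_congr_ae ?_
  filter_upwards [hAP] with p hp
  rw [h.lossOn_eq f f hp]
  simp

/-- In the second moment the cross terms vanish: the residual is orthogonal in mean to the kernel
function of the other point. The `n` diagonal terms are at most `2 κ Tr M` each, and `√2` is rounded
up to `2`. -/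
lemma IsBoundedSquareLoss.integral_gradNorm_le (h : IsBoundedSquareLoss H A ℓ) (hn : 0 < n)
    (hA : MeasurableSet A) (hAP : ∀ᵐ p ∂P, p ∈ A) (hH : HasDecomposableKernel H k M)
    (hk : Measurable fun p : X × X => k p.1 p.2) (hκ : ∀ x x' : X, k x x' ≤ κ) {f : H}
    (hf : ‖f‖ ≤ 1) (hmin : ∀ g : H, risk P ℓ f ≤ risk P ℓ g) :
    ∫ z, gradNorm A f z ∂(Measure.pi fun _ : Fin n => P) ≤ 2 * √(κ * M.trace / n) := by
  have hn' : (0 : ℝ) < n := Nat.cast_pos.2 hn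
  set F : X × EuclideanSpace ℝ (Fin d) → X × EuclideanSpace ℝ (Fin d) → ℝ := fun p q =>
    k p.1 q.1 * inner ℝ (residual A f p)
      (Matrix.toEuclideanCLM (𝕜 := ℝ) M (residual A f q)) with hF
  have hFm : Measurable fun p : (X × EuclideanSpace ℝ (Fin d)) × (X × EuclideanSpace ℝ (Fin d)) =>
      F p.1 p.2 := measurable_kernel_residual hA hH hk f
  have hFin : ∀ p q, F p q = inner ℝ (kerFun H p.1 (residual A f p))
      (kerFun H q.1 (residual A f q)) := fun p q => (hH.inner_kerFun_kerFun _ _ _ _).symm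
  have hFB : ∀ p q, |F p q| ≤ 2 * 2 := fun p q => by
    rw [hFin]
    exact (abs_real_inner_le_norm _ _).trans (mul_le_mul (h.norm_kerFun_residual_le hf p)
      (h.norm_kerFun_residual_le hf q) (norm_nonneg _) (by norm_num))
  have hdiag : ∀ p, F p p ≤ 2 * (κ * M.trace) := fun p => by
    rw [hFin, real_inner_self_eq_norm_sq]
    refine (hH.norm_kerFun_sq_le_trace hκ _ _).trans ?_
    have hpos : 0 ≤ κ * M.trace :=
      mul_nonneg ((hH.scalar.diag_nonneg p.1).trans (hκ _ _)) hH.trace_nonneg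
    nlinarith [h.norm_residual_sq_le hf p]
  have hoff : ∀ q, ∫ p, F p q ∂P = 0 := fun q => by
    have h0 := h.integral_inner_residual_eq_zero hA hAP hH hk hκ hf hmin
      (kerFun H q.1 (residual A f q))
    rw [← h0]
    refine integral_congr_ae (.of_forall fun p => ?_)
    simp only [hFin]
    rw [kerFun_inner, real_inner_comm]
  have hFi : ∀ i j : Fin n, Integrable (fun z : Fin n → X × EuclideanSpace ℝ (Fin d) =>
      F (z i) (z j)) (Measure.pi fun _ : Fin n => P) := fun i j =>
    integrable_of_abs_le (hFm.comp (measurable_eval_pair i j))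
      fun z => hFB _ _
  have hsecond : ∀ i j : Fin n, ∫ z, F (z i) (z j) ∂(Measure.pi fun _ : Fin n => P)
      ≤ if i = j then 2 * (κ * M.trace) else 0 := by
    intro i j
    split_ifs with hij
    · subst hij
      refine (integral_mono (hFi i i) (integrable_const _) fun z => hdiag (z i)).trans
        (le_of_eq ?_)
      simp
    · rw [integral_pair_pi hFm hFB hij]
      simp [hoff]
  have hint : ∫ z, gradNorm A f z ^ 2 ∂(Measure.pi fun _ : Fin n => P)
      ≤ 2 * (κ * M.trace / n) := by
    simp_rw [gradNorm_sq_eq hH]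
    rw [integral_const_mul]
    change (1 / (n : ℝ)) ^ 2 * ∫ z, ∑ i, ∑ j, F (z i) (z j) ∂(Measure.pi fun _ : Fin n => P) ≤ _
    rw [integral_finsetSum _ fun i _ => integrable_finsetSum _ fun j _ => hFi i j]
    simp_rw [fun i => integral_finsetSum (μ := Measure.pi fun _ : Fin n => P)
      Finset.univ fun j (_ : j ∈ Finset.univ) => hFi i j]
    refine (mul_le_mul_of_nonneg_left (Finset.sum_le_sum fun i _ => Finset.sum_le_sum fun j _ =>
      hsecond i j) (by positivity)).trans (le_of_eq ?_)
    simp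
    field_simp
  refine (integral_le_sqrt_integral_sq (measurable_gradNorm hA hH hk f)
    (h.abs_gradNorm_le hf)).trans ((Real.sqrt_le_sqrt hint).trans ?_)
  rw [Real.sqrt_mul (by norm_num)]
  refine mul_le_mul_of_nonneg_right ?_ (Real.sqrt_nonneg _)
  rw [Real.sqrt_le_left (by norm_num)]
  norm_num

end SquareLoss

end SketchedKernel

/-! ### The two excess risk bounds. -/

namespace SketchedKernel

section Main

variable {X : Type*} [MeasurableSpace X] {d : ℕ} {H : Type*} [NormedAddCommGroup H]
  [InnerProductSpace ℝ H] [RKHS ℝ H X (EuclideanSpace ℝ (Fin d))] [CompleteSpace H]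
  {A : Set (X × EuclideanSpace ℝ (Fin d))}
  {ℓ : EuclideanSpace ℝ (Fin d) → EuclideanSpace ℝ (Fin d) → ℝ}
  {k : X → X → ℝ} {M : Matrix (Fin d) (Fin d) ℝ} {n s : ℕ} {κ : ℝ}
  {P : Measure (X × EuclideanSpace ℝ (Fin d))} [IsProbabilityMeasure P]
  {Ω : Type*} [MeasurableSpace Ω] {Pr : Measure Ω} [IsProbabilityMeasure Pr]

omit [IsProbabilityMeasure P] [IsProbabilityMeasure Pr] in
lemma ae_forall_sample_mem {ζ : Fin n → Ω → X × EuclideanSpace ℝ (Fin d)}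
    (h_law : ∀ i, HasLaw (ζ i) P Pr) (hAP : ∀ᵐ p ∂P, p ∈ A) : ∀ᵐ ω ∂Pr, ∀ i, ζ i ω ∈ A := by
  rw [ae_all_iff]
  intro i
  rw [← (h_law i).map_eq] at hAP
  exact ae_of_ae_map (h_law i).aemeasurable hAP

omit [MeasurableSpace X] [CompleteSpace H] in
lemma sum_lossOn_eq (f : H) {z : Fin n → X × EuclideanSpace ℝ (Fin d)} (hz : ∀ i, z i ∈ A) :
    ∑ i, lossOn A ℓ f (z i) = ∑ i, ℓ (f (z i).1) (z i).2 :=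
  Finset.sum_congr rfl fun i _ => by rw [lossOn, Set.indicator_of_mem (hz i)]

/-- Excess risk of the sketched estimator for a Lipschitz loss. -/
theorem IsRegularLoss.sketched_excess_risk {L : ℝ} (h : IsRegularLoss H A ℓ L) (hn : 0 < n)
    (hA : MeasurableSet A) (hAP : ∀ᵐ p ∂P, p ∈ A)
    (hℓ : Measurable fun p : EuclideanSpace ℝ (Fin d) × EuclideanSpace ℝ (Fin d) => ℓ p.1 p.2)
    (hH : HasDecomposableKernel H k M) (hk : Measurable fun p : X × X => k p.1 p.2)
    (hκ : ∀ x x' : X, k x x' ≤ κ) {f : H} (hf : ‖f‖ ≤ 1)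
    {x : Fin n → Ω → X} {y : Fin n → Ω → EuclideanSpace ℝ (Fin d)}
    (h_law : ∀ i, HasLaw (fun ω => (x i ω, y i ω)) P Pr)
    (h_indep : iIndepFun (fun i ω => (x i ω, y i ω)) Pr)
    {U : Ω → Matrix (Fin n) (Fin n) ℝ} {ev : Ω → Fin n → ℝ}
    (h_eig : ∀ ω, IsEigendecomposition ((n : ℝ)⁻¹ • gram k (fun i => x i ω)) (U ω) (ev ω))
    {c : ℝ} (hc : 0 < c) {S : Ω → Matrix (Fin s) (Fin n) ℝ}
    (hS : ∀ᵐ ω ∂Pr, IsSatisfiable c (U ω) (ev ω) (S ω))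
    {lam : ℝ} (hlam : 0 < lam) {Γ : Ω → Matrix (Fin s) (Fin d) ℝ}
    (hΓ : ∀ᵐ ω ∂Pr, IsSketchedSolution H ℓ lam k M
      (fun i => x i ω) (fun i => y i ω) (S ω) (Γ ω))
    {δ : ℝ} (hδ : 0 < δ) (hδ1 : δ < 1) :
    WithProbAtLeast Pr (1 - δ)
      {ω | risk P ℓ (sketchedFun H (fun i => x i ω) (S ω) (Γ ω)) ≤
          risk P ℓ f
          + L * ((1 + √6 * c) * √(opNorm M * criticalRadius (ev ω) ^ 2))
          + lam / 2
          + 4 * L * √(κ * M.trace / n)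
          + 2 * √(8 * Real.log (4 / δ) / n)} := by
  have hlm := measurable_lossOn (ℓ := ℓ) hA hℓ hH hk f
  -- With `Ψ` the empirical risk of `f`, that risk cancels against the one reached through the
  -- competitor.
  obtain ⟨G, hG, hGp, hGz⟩ := h.exists_good_samples P hn hA hℓ hH hk hκ
    (fun z => (1 / (n : ℝ)) * ∑ i, lossOn A ℓ f (z i))
    ((Finset.measurable_sum _ fun i _ => hlm.comp (measurable_pi_apply i)).const_mul _)
    (abs_mean_le zero_le_one (h.abs_lossOn_le hf))
    (fun z i w => by
      rw [mean_sub_update]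
      have h1 := (h.lossOn_mem_Icc hf (z i)).2
      have h2 := (h.lossOn_mem_Icc hf w).1
      calc (1 / (n : ℝ)) * (lossOn A ℓ f (z i) - lossOn A ℓ f w) ≤ (1 / (n : ℝ)) * 7 :=
            mul_le_mul_of_nonneg_left (by linarith) (by positivity)
        _ = 7 / n := by ring) hδ hδ1
  rw [integral_mean_pi hn hlm (h.abs_lossOn_le hf), integral_lossOn hAP] at hGz
  refine withProbAtLeast_of_sample Pr P _ h_law h_indep hG hGp ?_
  filter_upwards [hS, hΓ, ae_forall_sample_mem h_law hAP] with ω hSω hΓω hAω hz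
  have h1 := hGz _ hz _ hΓω.mem_ball
  rw [integral_lossOn hAP, sum_lossOn_eq _ hAω, sum_lossOn_eq _ hAω] at h1
  obtain ⟨g, hg, hgf, hle⟩ := hΓω.exists_competitor hH hn hc (h_eig ω) hSω hlam f hf
  have h2 : (1 / (n : ℝ)) * ∑ i, ℓ (g (x i ω)) (y i ω)
      ≤ (1 / (n : ℝ)) * ∑ i, ℓ (f (x i ω)) (y i ω)
        + L * ((1 / (n : ℝ)) * ∑ i, ‖g (x i ω) - f (x i ω)‖) := by
    have : ∑ i, ℓ (g (x i ω)) (y i ω) ≤ ∑ i, (ℓ (f (x i ω)) (y i ω)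
        + L * ‖g (x i ω) - f (x i ω)‖) := Finset.sum_le_sum fun i _ => by
      have := (le_abs_self _).trans (h.lipschitz g f hg hf _ (hAω i))
      linarith
    rw [Finset.sum_add_distrib, ← Finset.mul_sum] at this
    have h3 := mul_le_mul_of_nonneg_left this (by positivity : (0 : ℝ) ≤ 1 / n)
    linarith
  have h3 : (1 / (n : ℝ)) * ∑ i, ‖g (x i ω) - f (x i ω)‖
      ≤ (1 + √6 * c) * √(opNorm M * criticalRadius (ev ω) ^ 2) := by
    refine (mean_le_sqrt_mean_sq _).trans ((Real.sqrt_le_sqrt hgf).trans (le_of_eq ?_))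
    rw [Real.sqrt_mul (by positivity), Real.sqrt_sq (by positivity)]
  have h4 := mul_le_mul_of_nonneg_left h3 h.nonneg
  linarith

/-- Excess risk of the sketched estimator for the square loss. -/
theorem IsBoundedSquareLoss.sketched_excess_risk (h : IsBoundedSquareLoss H A ℓ) (hn : 0 < n)
    (hA : MeasurableSet A) (hAP : ∀ᵐ p ∂P, p ∈ A)
    (hℓ : Measurable fun p : EuclideanSpace ℝ (Fin d) × EuclideanSpace ℝ (Fin d) => ℓ p.1 p.2)
    (hH : HasDecomposableKernel H k M) (hk : Measurable fun p : X × X => k p.1 p.2)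
    (hκ : ∀ x x' : X, k x x' ≤ κ) {f : H} (hf : ‖f‖ ≤ 1)
    (hmin : ∀ g : H, risk P ℓ f ≤ risk P ℓ g)
    {x : Fin n → Ω → X} {y : Fin n → Ω → EuclideanSpace ℝ (Fin d)}
    (h_law : ∀ i, HasLaw (fun ω => (x i ω, y i ω)) P Pr)
    (h_indep : iIndepFun (fun i ω => (x i ω, y i ω)) Pr)
    {U : Ω → Matrix (Fin n) (Fin n) ℝ} {ev : Ω → Fin n → ℝ}
    (h_eig : ∀ ω, IsEigendecomposition ((n : ℝ)⁻¹ • gram k (fun i => x i ω)) (U ω) (ev ω))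
    {c : ℝ} (hc : 0 < c) {S : Ω → Matrix (Fin s) (Fin n) ℝ}
    (hS : ∀ᵐ ω ∂Pr, IsSatisfiable c (U ω) (ev ω) (S ω))
    {lam : ℝ} (hlam : 0 < lam) {Γ : Ω → Matrix (Fin s) (Fin d) ℝ}
    (hΓ : ∀ᵐ ω ∂Pr, IsSketchedSolution H ℓ lam k M
      (fun i => x i ω) (fun i => y i ω) (S ω) (Γ ω))
    {δ : ℝ} (hδ : 0 < δ) (hδ1 : δ < 1) :
    WithProbAtLeast Pr (1 - δ)
      {ω | risk P ℓ (sketchedFun H (fun i => x i ω) (S ω) (Γ ω)) ≤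
          risk P ℓ f
          + (1 + √6 * c) ^ 2 * (opNorm M * criticalRadius (ev ω) ^ 2)
          + lam / 2
          + 8 * (√(κ * opNorm M) + 1) * √(κ * M.trace / n)
          + 2 * √(8 * Real.log (4 / δ) / n)} := by
  have hreg := h.isRegularLoss hH hκ
  have hom := measurable_offset hA hH hk f
  have hgm := measurable_gradNorm (n := n) hA hH hk f
  have hmm : Measurable fun z : Fin n → X × EuclideanSpace ℝ (Fin d) =>
      (1 / (n : ℝ)) * ∑ i, offset A f (z i) :=
    (Finset.measurable_sum _ fun i _ => hom.comp (measurable_pi_apply i)).const_mul _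
  have hmB := abs_mean_le (n := n) zero_le_one (h.abs_offset_le hf)
  -- `Ψ` majorizes the linear and constant parts of the competitor's empirical risk; its mean is at
  -- most `risk P ℓ f` plus the mean gradient norm.
  obtain ⟨G, hG, hGp, hGz⟩ := hreg.exists_good_samples P hn hA hℓ hH hk hκ
    (fun z => gradNorm A f z + (1 / (n : ℝ)) * ∑ i, offset A f (z i)) (hgm.add hmm)
    (fun z => (abs_add_le _ _).trans (add_le_add (h.abs_gradNorm_le hf z) (hmB z)))
    (fun z i w => by
      have h1 := h.gradNorm_sub_update_le hf z i w
      have h2 := mean_sub_update (offset A f) z i w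
      have h3 := (abs_le.1 (h.abs_offset_le hf (z i))).2
      have h4 := (abs_le.1 (h.abs_offset_le hf w)).1
      have h5 : (1 / (n : ℝ)) * (offset A f (z i) - offset A f w) ≤ (1 / (n : ℝ)) * 3 :=
        mul_le_mul_of_nonneg_left (by linarith) (by positivity)
      have h6 : (7 : ℝ) / n = 4 / n + 1 / n * 3 := by ring
      linarith) hδ hδ1
  rw [integral_add (integrable_of_abs_le hgm (h.abs_gradNorm_le hf))
    (integrable_of_abs_le hmm hmB), integral_mean_pi hn hom (h.abs_offset_le hf),
    h.integral_offset_eq hA hAP hH hk hκ hf hmin] at hGz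
  have hgrad := h.integral_gradNorm_le hn hA hAP hH hk hκ hf hmin
  refine withProbAtLeast_of_sample Pr P _ h_law h_indep hG hGp ?_
  filter_upwards [hS, hΓ, ae_forall_sample_mem h_law hAP] with ω hSω hΓω hAω hz
  have h1 := hGz _ hz _ hΓω.mem_ball
  rw [integral_lossOn hAP, sum_lossOn_eq _ hAω] at h1
  obtain ⟨g, hg, hgf, hle⟩ := hΓω.exists_competitor hH hn hc (h_eig ω) hSω hlam f hf
  have h2 : (1 / (n : ℝ)) * ∑ i, ℓ (g (x i ω)) (y i ω)
      = (1 / (n : ℝ)) * ∑ i, ‖g (x i ω) - f (x i ω)‖ ^ 2 / 2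
        + (1 / (n : ℝ)) * ∑ i, inner ℝ (g (x i ω)) (residual A f (x i ω, y i ω))
        + (1 / (n : ℝ)) * ∑ i, offset A f (x i ω, y i ω) := by
    rw [← mul_add, ← mul_add, ← Finset.sum_add_distrib, ← Finset.sum_add_distrib]
    congr 1
    exact Finset.sum_congr rfl fun i _ => h.lossOn_eq f g (hAω i)
  have h3 := mean_inner_residual_le (A := A) (f := f) hg fun i => (x i ω, y i ω)
  have h4 : (1 / (n : ℝ)) * ∑ i, ‖g (x i ω) - f (x i ω)‖ ^ 2 / 2
      ≤ (1 + √6 * c) ^ 2 * (opNorm M * criticalRadius (ev ω) ^ 2) := by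
    rw [← Finset.sum_div, mul_div_assoc']
    have : 0 ≤ (1 / (n : ℝ)) * ∑ i, ‖g (x i ω) - f (x i ω)‖ ^ 2 :=
      mul_nonneg (by positivity) (Finset.sum_nonneg fun _ _ => sq_nonneg _)
    linarith
  -- With Lipschitz constant `L = √(κ ‖M‖) + 1`, the deviation factor `4 L` and the gradient factor
  -- `2` are together at most `8 L`.
  have h5 : 0 ≤ √(κ * opNorm M) * √(κ * M.trace / n) := by positivity
  have h6 : 0 ≤ √(κ * M.trace / n) := by positivity
  simp only at h3 h1
  linarith

end Main

end SketchedKernel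

end

theorem theorem3
    {X : Type*} [MeasurableSpace X] {d n s : ℕ} (hn : 0 < n)
    -- the scalar kernel `k`, the output matrix `M`, and the RKHS `H` of the kernel `k M`
    (k : X → X → ℝ) (hk_meas : Measurable fun p : X × X => k p.1 p.2)
    (κ : ℝ) (hκ : ∀ x x' : X, k x x' ≤ κ)
    (M : Matrix (Fin d) (Fin d) ℝ) (hM : IsUnit M)
    (H : Type*) [NormedAddCommGroup H] [InnerProductSpace ℝ H] [CompleteSpace H]
    [RKHS ℝ H X (EuclideanSpace ℝ (Fin d))]
    (hH : SketchedKernel.HasDecomposableKernel H k M)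
    -- the output set `Y`, the distribution `P` on `X × Y`, and the loss
    (Y : Set (EuclideanSpace ℝ (Fin d)))
    (P : MeasureTheory.Measure (X × EuclideanSpace ℝ (Fin d)))
    [MeasureTheory.IsProbabilityMeasure P] (hPY : ∀ᵐ p ∂P, p.2 ∈ Y)
    (ℓ : EuclideanSpace ℝ (Fin d) → EuclideanSpace ℝ (Fin d) → ℝ)
    (hℓ_meas : Measurable
      fun p : EuclideanSpace ℝ (Fin d) × EuclideanSpace ℝ (Fin d) => ℓ p.1 p.2)
    (hℓ_mem : ∀ f : H, ‖f‖ ≤ 1 → ∀ x : X, ∀ y ∈ Y, ℓ (f x) y ∈ Set.Icc (0 : ℝ) 1)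
    -- the true risk is minimized over `H` at `fH`, which lies in the unit ball
    (fH : H) (hfH_min : ∀ f : H, SketchedKernel.risk P ℓ fH ≤ SketchedKernel.risk P ℓ f)
    (hfH_ball : ‖fH‖ ≤ 1)
    -- the i.i.d. sample
    {Ω : Type*} [MeasurableSpace Ω] (Pr : MeasureTheory.Measure Ω)
    [MeasureTheory.IsProbabilityMeasure Pr]
    (x : Fin n → Ω → X) (y : Fin n → Ω → EuclideanSpace ℝ (Fin d))
    (h_law : ∀ i, ProbabilityTheory.HasLaw (fun ω => (x i ω, y i ω)) P Pr)
    (h_indep : ProbabilityTheory.iIndepFun (fun i ω => (x i ω, y i ω)) Pr)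
    -- the eigendecomposition of `K / n`, and the `K`-satisfiable sketch
    (U : Ω → Matrix (Fin n) (Fin n) ℝ) (ev : Ω → Fin n → ℝ)
    (h_eig : ∀ ω, SketchedKernel.IsEigendecomposition
      ((n : ℝ)⁻¹ • SketchedKernel.gram k (fun i => x i ω)) (U ω) (ev ω))
    (c : ℝ) (hc : 0 < c) (S : Ω → Matrix (Fin s) (Fin n) ℝ)
    (hS : ∀ᵐ ω ∂Pr, SketchedKernel.IsSatisfiable c (U ω) (ev ω) (S ω))
    -- the sketched estimator
    (lam : ℝ) (hlam : 0 < lam) (Γ : Ω → Matrix (Fin s) (Fin d) ℝ)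
    (hΓ : ∀ᵐ ω ∂Pr, SketchedKernel.IsSketchedSolution H ℓ lam k M
      (fun i => x i ω) (fun i => y i ω) (S ω) (Γ ω))
    (C : ℝ) (hC : C = 1 + √6 * c) :
    (∀ L : NNReal, (∀ y' ∈ Y, LipschitzWith L fun z => ℓ z y') →
      ∀ δ : ℝ, 0 < δ → δ < 1 →
        SketchedKernel.WithProbAtLeast Pr (1 - δ)
          {ω | SketchedKernel.risk P ℓ
                (SketchedKernel.sketchedFun H (fun i => x i ω) (S ω) (Γ ω)) ≤
              SketchedKernel.risk P ℓ fH
              + L * C * √(lam + SketchedKernel.opNorm M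
                  * SketchedKernel.criticalRadius (ev ω) ^ 2)
              + lam / 2
              + 8 * L * √(κ * M.trace / n)
              + 2 * √(8 * Real.log (4 / δ) / n)}) ∧
    ((∀ z y' : EuclideanSpace ℝ (Fin d), ℓ z y' = ‖z - y'‖ ^ 2 / 2) →
      Y ⊆ Metric.closedBall 0 1 →
      ∀ δ : ℝ, 0 < δ → δ < 1 →
        SketchedKernel.WithProbAtLeast Pr (1 - δ)
          {ω | SketchedKernel.risk P ℓ
                (SketchedKernel.sketchedFun H (fun i => x i ω) (S ω) (Γ ω)) ≤
              SketchedKernel.risk P ℓ fH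
              + (C ^ 2 + 1 / 2) * lam
              + C ^ 2 * SketchedKernel.opNorm M * SketchedKernel.criticalRadius (ev ω) ^ 2
              + 8 * √M.trace * ((κ * √(SketchedKernel.opNorm M) + √κ) / √n)
              + 2 * √(8 * Real.log (4 / δ) / n)}) := by
  classical
  -- `Y` need not be measurable; `A` is a measurable set of full measure whose outputs all lie in
  -- `Y`.
  set A : Set (X × EuclideanSpace ℝ (Fin d)) := (toMeasurable P {p | p.2 ∉ Y})ᶜ with hAdef
  have hA : MeasurableSet A := (measurableSet_toMeasurable _ _).compl
  have hAY : ∀ p ∈ A, p.2 ∈ Y := fun p hp => by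
    by_contra hpY
    exact hp (subset_toMeasurable _ _ hpY)
  have hAP : ∀ᵐ p ∂P, p ∈ A := by
    have h0 : P (toMeasurable P {p | p.2 ∉ Y}) = 0 := by
      rw [measure_toMeasurable]; exact hPY
    rw [ae_iff]
    simpa [hAdef] using h0
  subst hC
  refine ⟨fun L hL δ hδ hδ1 => ?_, fun hsq hY δ hδ hδ1 => ?_⟩
  · have hreg : SketchedKernel.IsRegularLoss H A ℓ L :=
      { nonneg := L.2
        mem_Icc := fun f hf p hp => hℓ_mem f hf p.1 p.2 (hAY p hp)
        lipschitz := fun f g _ _ p hp => by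
          have := (hL p.2 (hAY p hp)).dist_le_mul (f p.1) (g p.1)
          rwa [Real.dist_eq, dist_eq_norm] at this }
    obtain ⟨G, hG, hGs, hGp⟩ := hreg.sketched_excess_risk hn hA hAP hℓ_meas hH hk_meas hκ hfH_ball
      h_law h_indep h_eig hc hS hlam hΓ hδ hδ1
    refine ⟨G, hG, fun ω hω => ?_, hGp⟩
    have h0 := hGs hω
    rw [Set.mem_ofPred_eq] at h0 ⊢
    refine h0.trans ?_
    -- The approximation bound has no `lam` under the root; adding it only weakens the estimate.
    have h1 : √(SketchedKernel.opNorm M * SketchedKernel.criticalRadius (ev ω) ^ 2)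
        ≤ √(lam + SketchedKernel.opNorm M * SketchedKernel.criticalRadius (ev ω) ^ 2) :=
      Real.sqrt_le_sqrt (by linarith)
    have h2 : (L : ℝ) * ((1 + √6 * c)
          * √(SketchedKernel.opNorm M * SketchedKernel.criticalRadius (ev ω) ^ 2))
        ≤ L * (1 + √6 * c)
          * √(lam + SketchedKernel.opNorm M * SketchedKernel.criticalRadius (ev ω) ^ 2) := by
      rw [← mul_assoc]
      exact mul_le_mul_of_nonneg_left h1 (by positivity)
    have h3 : 0 ≤ (L : ℝ) * √(κ * M.trace / n) := by positivity
    linarith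
  · have hb : SketchedKernel.IsBoundedSquareLoss H A ℓ :=
      { eq := hsq
        le_one := fun f hf p hp => (hℓ_mem f hf p.1 p.2 (hAY p hp)).2
        norm_le_one := fun p hp => by simpa using hY (hAY p hp) }
    obtain ⟨G, hG, hGs, hGp⟩ := hb.sketched_excess_risk hn hA hAP hℓ_meas hH hk_meas hκ hfH_ball
      hfH_min h_law h_indep h_eig hc hS hlam hΓ hδ hδ1
    refine ⟨G, hG, fun ω hω => ?_, hGp⟩
    have h0 := hGs hω
    rw [Set.mem_ofPred_eq] at h0 ⊢
    refine h0.trans ?_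
    -- A point of `X` is needed to get `0 ≤ κ`, which lets the square roots be split.
    have hX : Nonempty (X × EuclideanSpace ℝ (Fin d)) := Measure.nonempty_of_neZero P
    obtain ⟨x₀, -⟩ := hX
    have hκ0 : 0 ≤ κ := (hH.scalar.diag_nonneg x₀).trans (hκ x₀ x₀)
    have h1 : 8 * (√(κ * SketchedKernel.opNorm M) + 1) * √(κ * M.trace / n)
        = 8 * √M.trace * ((κ * √(SketchedKernel.opNorm M) + √κ) / √n) := by
      rw [Real.sqrt_mul hκ0, Real.sqrt_div (mul_nonneg hκ0 hH.trace_nonneg), Real.sqrt_mul hκ0]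
      have h2 : κ * √(SketchedKernel.opNorm M) = √κ * √κ * √(SketchedKernel.opNorm M) := by
        rw [Real.mul_self_sqrt hκ0]
      rw [h2]
      ring
    have h3 : 0 ≤ (1 + √6 * c) ^ 2 * lam := by positivity
    rw [h1]
    linarith
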